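/- **Setting.** A vector or matrix inequality is entrywise. Fix $n$ and a measurable $g$ with $g\ge 0$ on $[0,\infty)$ and $\int_{\mathbb R^{n+1}} g(\|v\|^2)\,dv=1$. For a positive definite $(n+1)\times(n+1)$ matrix $S$, let $EC_{n+1}(0,S,g)$ be the law on $\mathbb R^{n+1}$ with density $|S|^{-1/2}g(w'S^{-1}w)$. Let $\mu\in\mathbb R^n$, let $\Omega=(\omega_{ij})$ be a positive definite $n\times n$ matrix, and let $\delta\in(-1,1)^n$. Put $\omega=\mathrm{diag}(\sqrt{\omega_{11}},\dots,\sqrt{\omega_{nn}})$, $\Delta=\mathrm{diag}(\sqrt{1-\delta_1^2},\dots,\sqrt{1-\delta_n^2})$, $\lambda_i=\delta_i(1-\delta_i^2)^{-1/2}$, $\Psi=\Delta^{-1}\omega^{-1}\Omega\,\omega^{-1}\Delta^{-1}$ and $\delta_w=\omega\delta$, and assume that $\Psi-\lambda\lambda'$ is positive definite. A random vector $X$ is skew-elliptical with parameters $(\mu,\Omega,\delta,g)$ if $$X\overset{d}{=}\mu+\omega\bigl(\delta|U_0|+\Delta U_1\bigr),\qquad (U_0,U_1')'\sim EC_{n+1}\Bigl(0,\begin{pmatrix}1&0\\0&\Psi-\lambda\lambda'\end{pmatrix},g\Bigr).$$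 For a class $\mathcal F$ of functions $f:\mathbb R^n\to\mathbb R$, write $X\le_{\mathcal F}Y$ if $E f(X)\le E f(Y)$ for all measurable $f\in\mathcal F$ for which both expectations are well defined (possibly infinite). A symmetric matrix $M$ is copositive if $x'Mx\ge0$ for all $x\ge0$. A matrix $M$ is completely positive if $M=B'B$ for some entrywise non-negative $m\times n$ matrix $B$. Let $H_f$ denote the Hessian of $f$. The orders are generated by the following classes: * $st$: increasing functions (for the componentwise order); * $icx$: increasing convex functions; * $ism$, $idcx$, $iccx$: twice differentiable $f$ with $\nabla f\ge0$ everywhere and, everywhere, $\partial_i\partial_jf\ge0$ for all $i<j$ (ism), for all $i,j$ (idcx), respectively $\partial_i^2f\ge0$ for all $i$ (iccx); * $icp$, $icop$: $C^2$ functions $f$ with $\nabla f\ge0$ everywhere and $H_f(x)$ completely positive (icp), respectively copositive (icop), for all $x$; * $uo$: $C^\infty$ functions $f$ with $\partial^kf/\partial x_{i_1}\cdots\partial x_{i_k}\ge0$ everywhere for all $k\ge1$ and $i_1<\dots<i_k$. **Theorem 3.6.** Let $X$ and $Y$ be skew-elliptical with parameters $(\mu^x,\Omega^x,\delta^x,g)$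 and $(\mu^y,\Omega^y,\delta^y,g)$ (same $n$ and $g$). Suppose $\mu^x\le\mu^y$ and $\delta^x_w\le\delta^y_w$. 1. If $\Omega^x=\Omega^y$, then $X\le_{st}Y$. 2. If $\Omega^y-\Omega^x$ is positive semi-definite, then $X\le_{icx}Y$. 3. If $\omega^x_{ii}=\omega^y_{ii}$ for all $i$ and $\omega^x_{ij}\le\omega^y_{ij}$ for all $i\ne j$, then $X\le_{ism}Y$. 4. If $\omega^x_{ij}\le\omega^y_{ij}$ for all $i,j$, then $X\le_{idcx}Y$. 5. If $\omega^x_{ii}\le\omega^y_{ii}$ for all $i$ and $\omega^x_{ij}=\omega^y_{ij}$ for all $i<j$, then $X\le_{iccx}Y$. 6. If $\Omega^y-\Omega^x$ is copositive, then $X\le_{icp}Y$. 7. If $\Omega^y-\Omega^x$ is completely positive, then $X\le_{icop}Y$. 8. If $\omega^x_{ii}=\omega^y_{ii}$ for all $i$ and $\omega^x_{ij}\le\omega^y_{ij}$ for all $i\ne j$, then $X\le_{uo}Y$. -/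

import Mathlib

open MeasureTheory ProbabilityTheory Matrix

noncomputable section

namespace SkewElliptical

/-! ### Skew-elliptical distributions -/

/-- `g` is the density generator of elliptical distributions with coordinates indexed by `ι`: it is
measurable, non-negative on `[0, ∞)`, and `v ↦ g (‖v‖²)` (Euclidean norm) is a probability
density on `ℝ^ι`. -/
structure IsDensityGenerator (ι : Type*) [Fintype ι] (g : ℝ → ℝ) : Prop where
  measurable : Measurable g
  nonneg : ∀ s, 0 ≤ s → 0 ≤ g s
  lintegral_eq_one : ∫⁻ v : ι → ℝ, ENNReal.ofReal (g (∑ i, v i ^ 2)) = 1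

/-- The elliptical distribution with location `m`, scale matrix `S` and density generator `g`: the
measure with Lebesgue density `|S|^{-1/2} g ((x - m)' S⁻¹ (x - m))`. It is only used for
positive definite `S`. -/
def elliptical {ι : Type*} [Fintype ι] [DecidableEq ι] (m : ι → ℝ) (S : Matrix ι ι ℝ)
    (g : ℝ → ℝ) : Measure (ι → ℝ) :=
  volume.withDensity fun x =>
    ENNReal.ofReal ((√S.det)⁻¹ * g ((x - m) ⬝ᵥ (S⁻¹ *ᵥ (x - m))))

variable {n : ℕ}

/-- The vector `δ_ω = ω δ`, where `ω = diag (√Ω₁₁, …, √Ωₙₙ)`. -/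
def deltaW (Om : Matrix (Fin n) (Fin n) ℝ) (δ : Fin n → ℝ) : Fin n → ℝ :=
  fun i => √(Om i i) * δ i

/-- The vector `λ` with entries `λᵢ = δᵢ (1 - δᵢ²)^{-1/2}`. -/
def lam (δ : Fin n → ℝ) : Fin n → ℝ := fun i => δ i / √(1 - δ i ^ 2)

/-- The matrix `Ψ = Δ⁻¹ ω⁻¹ Ω ω⁻¹ Δ⁻¹`, where `Δ = diag (√(1 - δ₁²), …, √(1 - δₙ²))` and
`ω = diag (√Ω₁₁, …, √Ωₙₙ)`. -/
def psi (Om : Matrix (Fin n) (Fin n) ℝ) (δ : Fin n → ℝ) : Matrix (Fin n) (Fin n) ℝ :=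
  Matrix.of fun i j =>
    Om i j / (√(Om i i) * √(1 - δ i ^ 2) * (√(Om j j) * √(1 - δ j ^ 2)))

/-- The scale matrix `Ψ - λ λ'` of `U₁`; it has unit diagonal. -/
def scaleU (Om : Matrix (Fin n) (Fin n) ℝ) (δ : Fin n → ℝ) : Matrix (Fin n) (Fin n) ℝ :=
  psi Om δ - vecMulVec (lam δ) (lam δ)

/-- The random vector `X` on `(A, P)` has the `n`-dimensional skew-elliptical distribution with
location `μ`, full-rank scale matrix `Om`, skewness `δ` and `(n+1)`-dimensional density
generator `g`: in law, `X = μ + ω (δ |U₀| + Δ U₁)`, where `(U₀, U₁)` is elliptical on `ℝ^{1+n}` with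
location `0`, scale matrix `diag (1, Ψ - λ λ')` and generator `g`.

With `δ_ω = ω δ` and `α = (1 - δ_ω' Ω⁻¹ δ_ω)^{-1/2} Ω⁻¹ δ_ω`, this is the law with density
`2 |Ω|^{-1/2} ∫_{-∞}^{α'(x - μ)} g ((x - μ)' Ω⁻¹ (x - μ) + s²) ds`. -/
structure IsSkewElliptical {A : Type*} [MeasurableSpace A] (P : Measure A) (X : A → Fin n → ℝ)
    (μ : Fin n → ℝ) (Om : Matrix (Fin n) (Fin n) ℝ) (δ : Fin n → ℝ) (g : ℝ → ℝ) : Prop where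
  generator : IsDensityGenerator (Unit ⊕ Fin n) g
  scale_posDef : Om.PosDef
  delta_mem : ∀ i, δ i ∈ Set.Ioo (-1 : ℝ) 1
  scaleU_posDef : (scaleU Om δ).PosDef
  hasLaw : HasLaw X
    ((elliptical (0 : Unit ⊕ Fin n → ℝ) (Matrix.fromBlocks 1 0 0 (scaleU Om δ)) g).map
      fun u i => μ i + √(Om i i) *
        (δ i * |u (Sum.inl ())| + √(1 - δ i ^ 2) * u (Sum.inr i))) P

/-! ### Cones of matrices -/

/-- `A` is copositive: `x' A x ≥ 0` for all `x ≥ 0`. -/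
def IsCopositive (M : Matrix (Fin n) (Fin n) ℝ) : Prop :=
  M.IsSymm ∧ ∀ x : Fin n → ℝ, 0 ≤ x → 0 ≤ x ⬝ᵥ (M *ᵥ x)

/-- `A` is completely positive: `A = B' B` for some entrywise non-negative `m × n` matrix `B`. -/
def IsCompletelyPositive (M : Matrix (Fin n) (Fin n) ℝ) : Prop :=
  ∃ (m : ℕ) (B : Matrix (Fin m) (Fin n) ℝ), (∀ i j, 0 ≤ B i j) ∧ M = Bᵀ * B

/-! ### Expectations and integral stochastic orders -/

/-- The expectation of `h` is well defined, possibly infinite: not both the positive and the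
negative part of `h` have infinite integral. -/
def ExpectationDefined {A : Type*} [MeasurableSpace A] (P : Measure A) (h : A → ℝ) : Prop :=
  ∫⁻ a, ENNReal.ofReal (h a) ∂P ≠ ⊤ ∨ ∫⁻ a, ENNReal.ofReal (-h a) ∂P ≠ ⊤

/-- The expectation of `h` in `[-∞, ∞]`, meaningful under `ExpectationDefined`. -/
def expectation {A : Type*} [MeasurableSpace A] (P : Measure A) (h : A → ℝ) : EReal :=
  ((∫⁻ a, ENNReal.ofReal (h a) ∂P : ENNReal) : EReal) -
    ((∫⁻ a, ENNReal.ofReal (-h a) ∂P : ENNReal) : EReal)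

/-- The integral stochastic order generated by the class `F`: `E f(X) ≤ E f(Y)` for all measurable
`f` in `F` for which both expectations are well defined. -/
def IntegralOrder {A B : Type*} [MeasurableSpace A] [MeasurableSpace B]
    (F : Set ((Fin n → ℝ) → ℝ)) (P : Measure A) (X : A → Fin n → ℝ)
    (Q : Measure B) (Y : B → Fin n → ℝ) : Prop :=
  ∀ f ∈ F, Measurable f →
    ExpectationDefined P (fun a => f (X a)) → ExpectationDefined Q (fun b => f (Y b)) →
      expectation P (fun a => f (X a)) ≤ expectation Q (fun b => f (Y b))

/-! ### Classes of functions -/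

/-- The partial derivative `∂f/∂xᵢ`. -/
def partialDeriv (i : Fin n) (f : (Fin n → ℝ) → ℝ) : (Fin n → ℝ) → ℝ :=
  fun x => fderiv ℝ f x (Pi.single i 1)

/-- The Hessian matrix `(∂²f/∂xᵢ∂xⱼ)`. -/
def hessian (f : (Fin n → ℝ) → ℝ) (x : Fin n → ℝ) : Matrix (Fin n) (Fin n) ℝ :=
  Matrix.of fun i j => partialDeriv i (partialDeriv j f) x

/-- The iterated partial derivative `∂ᵏf/∂x_{i₁}⋯∂x_{iₖ}` for the list `[i₁, …, iₖ]`. -/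
def iterPartialDeriv (l : List (Fin n)) (f : (Fin n → ℝ) → ℝ) : (Fin n → ℝ) → ℝ :=
  l.foldr partialDeriv f

/-- `f` is (Fréchet) differentiable and so is its derivative. -/
def TwiceDifferentiable (f : (Fin n → ℝ) → ℝ) : Prop :=
  Differentiable ℝ f ∧ Differentiable ℝ (fderiv ℝ f)

/-- Non-negative gradient everywhere. -/
def NonnegGradient (f : (Fin n → ℝ) → ℝ) : Prop :=
  ∀ x i, 0 ≤ partialDeriv i f x

/-- Increasing functions (with respect to the componentwise order). -/
def increasing (n : ℕ) : Set ((Fin n → ℝ) → ℝ) := {f | Monotone f}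

/-- Increasing convex functions. -/
def increasingConvex (n : ℕ) : Set ((Fin n → ℝ) → ℝ) :=
  {f | Monotone f ∧ ConvexOn ℝ Set.univ f}

/-- Increasing supermodular functions. -/
def increasingSupermodular (n : ℕ) : Set ((Fin n → ℝ) → ℝ) :=
  {f | TwiceDifferentiable f ∧ NonnegGradient f ∧ ∀ x i j, i < j → 0 ≤ hessian f x i j}

/-- Increasing directionally convex functions. -/
def increasingDirConvex (n : ℕ) : Set ((Fin n → ℝ) → ℝ) :=
  {f | TwiceDifferentiable f ∧ NonnegGradient f ∧ ∀ x i j, 0 ≤ hessian f x i j}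

/-- Increasing componentwise convex functions. -/
def increasingCompConvex (n : ℕ) : Set ((Fin n → ℝ) → ℝ) :=
  {f | TwiceDifferentiable f ∧ NonnegGradient f ∧ ∀ x i, 0 ≤ hessian f x i i}

/-- Increasing `C²` functions with completely positive Hessian. -/
def increasingCP (n : ℕ) : Set ((Fin n → ℝ) → ℝ) :=
  {f | ContDiff ℝ 2 f ∧ NonnegGradient f ∧ ∀ x, IsCompletelyPositive (hessian f x)}

/-- Increasing `C²` functions with copositive Hessian. -/
def increasingCop (n : ℕ) : Set ((Fin n → ℝ) → ℝ) :=
  {f | ContDiff ℝ 2 f ∧ NonnegGradient f ∧ ∀ x, IsCopositive (hessian f x)}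

/-- The class generating the upper orthant order: smooth functions all of whose partial derivatives
`∂ᵏf/∂x_{i₁}⋯∂x_{iₖ}` with `k ≥ 1` and `i₁ < ⋯ < iₖ` are non-negative. -/
def upperOrthant (n : ℕ) : Set ((Fin n → ℝ) → ℝ) :=
  {f | ContDiff ℝ ((⊤ : ℕ∞) : WithTop ℕ∞) f ∧
    ∀ l : List (Fin n), l ≠ [] → l.Pairwise (· < ·) → ∀ x, 0 ≤ iterPartialDeriv l f x}

end SkewElliptical

end

noncomputable section

namespace SkewElliptical

open Filter Topology

/-! ### Radial weights -/

/-! In law X = μ + δ_w |W| + K Z with (W, Z) spherical and δ_w δ_w' + K K' = Ω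
(`IsSkewElliptical.exists_factor`). This is even in W, so averages of f(X) are twice the averages
over the half-space W > 0. There the map is affine, and (W, δ_w W + K Z) is elliptical with scale
matrix [[1, δ_w'], [δ_w, Ω]]. The skewness has become an off-diagonal block, and the task is to
compare two elliptical laws on the test function 1_{w>0} f(z).

For a C² function F and a radial weight, the average of F(N v) dominates that of F(M v) as soon as ∑
(N N' - M M')_{jk} ∂_j∂_k F ≥ 0 everywhere (`integral_radial_le_of_scale`): diagonalize both scales
simultaneously, move the squared half-axes along a straight line, and read the sign of the
derivative from Stein's identity (`integral_coord_mul_radial`). Take F = χ(w) f(z) with χ smooth,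
non-negative and increasing (`integral_cutoff_le`). The ww entry of the difference of scales is 0,
so χ'' never enters; the cross blocks give 2 χ' ∑ (δ_w^y - δ_w^x)_i ∂_i f ≥ 0; the last block gives
χ ∑ (Ω^y - Ω^x)_{ij} ∂_i∂_j f. Then χ tends to the indicator of w > 0.

The orders differ only in why ∑ (Ω^y - Ω^x)_{ij} ∂_i∂_j f ≥ 0: the difference of the scales is
paired with a cone of Hessians. The class of `uo` is contained in that of `ism`.

The rest is regularity. If f is not C², its second-order condition is stated by second differences,
which survive mollification (`halfSpaceLe_of_secondDiff`). A merely measurable g is truncated to a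
ball and approximated in L¹ by continuous weights. Monotone functions are bounded on bounded sets,
so truncated integrals are finite without moment assumptions, and monotone convergence removes the
truncation. -/

/-- The squared Euclidean norm of a coordinate vector. -/
def sumSq {ι : Type*} [Fintype ι] (v : ι → ℝ) : ℝ := ∑ i, v i ^ 2

section Radial

variable {ι : Type*} [Fintype ι]

lemma continuous_sumSq : Continuous (sumSq : (ι → ℝ) → ℝ) := by
  unfold sumSq; fun_prop

lemma sumSq_nonneg (v : ι → ℝ) : 0 ≤ sumSq v :=
  Finset.sum_nonneg fun _ _ => sq_nonneg _

lemma abs_le_of_sumSq_le {v : ι → ℝ} {R : ℝ} (h : sumSq v ≤ R) (i : ι) : |v i| ≤ R + 1 := by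
  have h1 : v i ^ 2 ≤ R :=
    (Finset.single_le_sum (f := fun j => v j ^ 2) (fun j _ => sq_nonneg _)
      (Finset.mem_univ i)).trans h
  rw [abs_le]
  constructor <;> nlinarith [sq_nonneg (v i - 1), sq_nonneg (v i + 1)]

lemma norm_le_of_sumSq_le {v : ι → ℝ} {R : ℝ} (h : sumSq v ≤ R) : ‖v‖ ≤ R + 1 := by
  have hR : 0 ≤ R := (sumSq_nonneg v).trans h
  rw [pi_norm_le_iff_of_nonneg (by linarith)]
  exact fun i => abs_le_of_sumSq_le h i

lemma isCompact_sumSq_le (R : ℝ) : IsCompact {v : ι → ℝ | sumSq v ≤ R} := by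
  refine (ProperSpace.isCompact_closedBall (0 : ι → ℝ) (R + 1)).of_isClosed_subset
    (isClosed_le continuous_sumSq continuous_const) fun v hv => ?_
  simpa using norm_le_of_sumSq_le hv

variable {p : ℝ → ℝ} {R : ℝ}

lemma radial_eq_zero (hR : ∀ s, R ≤ s → p s = 0) {v : ι → ℝ} (hv : v ∉ {v : ι → ℝ | sumSq v ≤ R}) :
    p (sumSq v) = 0 :=
  hR _ (not_le.1 hv).le

lemma hasCompactSupport_radial (hR : ∀ s, R ≤ s → p s = 0) :
    HasCompactSupport fun v : ι → ℝ => p (sumSq v) :=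
  HasCompactSupport.intro (isCompact_sumSq_le R) fun _ hv => radial_eq_zero hR hv

lemma integrable_mul_radial (hp : Continuous p) (hR : ∀ s, R ≤ s → p s = 0) {h : (ι → ℝ) → ℝ}
    (hh : Continuous h) : Integrable fun v : ι → ℝ => h v * p (sumSq v) :=
  (hh.mul (hp.comp continuous_sumSq)).integrable_of_hasCompactSupport
    (hasCompactSupport_radial hR).mul_left

/-- A measurable function that is bounded on bounded sets is integrable against a continuous
compactly supported radial weight. -/
lemma integrable_mul_radial_of_bdd (hp : Continuous p) (hR : ∀ s, R ≤ s → p s = 0)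
    {h : (ι → ℝ) → ℝ} (hh : Measurable h) {C : ℝ} (hC : ∀ v, sumSq v ≤ R → |h v| ≤ C) :
    Integrable fun v : ι → ℝ => h v * p (sumSq v) := by
  have h1 : Integrable fun v : ι → ℝ => C * |p (sumSq v)| := by
    have := (integrable_mul_radial (ι := ι) hp hR (h := fun _ => 1) continuous_const).abs
    simp only [one_mul] at this
    exact this.const_mul C
  refine h1.mono' (hh.mul (hp.measurable.comp continuous_sumSq.measurable)).aestronglyMeasurable
    (Eventually.of_forall fun v => ?_)
  rw [Real.norm_eq_abs, abs_mul]
  by_cases hv : sumSq v ≤ R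
  · exact mul_le_mul_of_nonneg_right (hC v hv) (abs_nonneg _)
  · simp [hR _ (not_le.1 hv).le]

/-- The tail of `p`, halved. -/
def halfTail (p : ℝ → ℝ) (R s : ℝ) : ℝ := (∫ τ in s..R, p τ) / 2

lemma halfTail_eq_zero (hR : ∀ s, R ≤ s → p s = 0) {s : ℝ} (h : R ≤ s) : halfTail p R s = 0 := by
  unfold halfTail
  have : ∫ τ in s..R, p τ = 0 := by
    rw [intervalIntegral.integral_congr (g := fun _ => 0)]
    · simp
    · intro x hx
      rw [Set.uIcc_of_ge h] at hx
      exact hR x hx.1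
  rw [this]; simp

lemma halfTail_nonneg (hp0 : ∀ s, 0 ≤ p s) (hR : ∀ s, R ≤ s → p s = 0) (s : ℝ) :
    0 ≤ halfTail p R s := by
  rcases le_total s R with h | h
  · exact div_nonneg (intervalIntegral.integral_nonneg h fun x _ => hp0 x) zero_le_two
  · exact (halfTail_eq_zero hR h).ge

lemma hasDerivAt_halfTail (hp : Continuous p) (s : ℝ) :
    HasDerivAt (halfTail p R) (-p s / 2) s :=
  (intervalIntegral.integral_hasDerivAt_left (hp.intervalIntegrable _ _)
    (hp.stronglyMeasurableAtFilter _ _) hp.continuousAt).div_const 2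

lemma continuous_halfTail (hp : Continuous p) : Continuous (halfTail p R) :=
  continuous_iff_continuousAt.2 fun s => (hasDerivAt_halfTail hp s).continuousAt

lemma hasFDerivAt_sumSq (v : ι → ℝ) :
    HasFDerivAt (sumSq : (ι → ℝ) → ℝ)
      (∑ i, (2 * v i) • ContinuousLinearMap.proj (R := ℝ) (φ := fun _ : ι => ℝ) i) v := by
  unfold sumSq
  refine HasFDerivAt.fun_sum fun i _ => ?_
  have h := (ContinuousLinearMap.proj (R := ℝ) (φ := fun _ : ι => ℝ) i).hasFDerivAt (x := v)
  simpa using h.pow 2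

/-- Stein's identity for radial weights. -/
lemma integral_coord_mul_radial [DecidableEq ι] (hp : Continuous p) (hR : ∀ s, R ≤ s → p s = 0)
    {h : (ι → ℝ) → ℝ} (hh : ContDiff ℝ 1 h) (i : ι) :
    ∫ v, v i * h v * p (sumSq v) =
      ∫ v, fderiv ℝ h v (Pi.single i 1) * halfTail p R (sumSq v) := by
  have hG : ∀ v : ι → ℝ, HasFDerivAt (fun v => halfTail p R (sumSq v))
      ((-p (sumSq v) / 2) •
        ∑ i, (2 * v i) • ContinuousLinearMap.proj (R := ℝ) (φ := fun _ : ι => ℝ) i) v :=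
    fun v => (hasDerivAt_halfTail hp _).comp_hasFDerivAt v (hasFDerivAt_sumSq v)
  -- The half in `halfTail` cancels the 2 in the gradient of `sumSq`, so `halfTail p R ∘ sumSq` is a
  -- potential for -v p(|v|²). The identity is then integration by parts.
  have hG' : ∀ v : ι → ℝ, fderiv ℝ (fun v => halfTail p R (sumSq v)) v (Pi.single i 1) =
      -(v i * p (sumSq v)) := by
    intro v
    rw [(hG v).fderiv]
    simp [Pi.single_apply]
    ring
  have hR' : ∀ s, R ≤ s → halfTail p R s = 0 := fun s => halfTail_eq_zero hR
  have hd : Continuous fun v => fderiv ℝ h v (Pi.single i 1) :=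
    (hh.continuous_fderiv (by simp)).clm_apply continuous_const
  have key := integral_mul_fderiv_eq_neg_fderiv_mul_of_integrable (μ := volume) (f := h)
    (g := fun v => halfTail p R (sumSq v)) (v := Pi.single i 1)
    (integrable_mul_radial (continuous_halfTail hp) hR' hd)
    (by
      simp only [hG']
      have := integrable_mul_radial hp hR (h := fun v => -(v i * h v))
        (((continuous_apply i).mul hh.continuous).neg)
      refine this.congr (Eventually.of_forall fun v => ?_)
      simp only; ring)
    (integrable_mul_radial (continuous_halfTail hp) hR' hh.continuous)
    (fun x _ => (hh.differentiable (by simp)).differentiableAt)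
    (fun x _ => (hG x).differentiableAt)
  simp only [hG'] at key
  rw [← neg_inj, ← key, ← integral_neg]
  refine integral_congr_ae (Eventually.of_forall fun v => ?_)
  simp only; ring

end Radial

/-! ### Monotonicity of radial averages along a path of ellipsoids -/

section Path

variable {ι : Type*} [Fintype ι] {p : ℝ → ℝ} {R : ℝ}

/-- If `F` is `C²` and `∑ᵢ (dᵢ - 1) D²F(aᵢ, aᵢ) ≥ 0`, then the radial average of `F` over the
ellipsoid with half-axes `aᵢ` increases when the half-axes are rescaled by `√dᵢ`. -/
lemma integral_radial_le_of_axes {E : Type*} [NormedAddCommGroup E]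
    [NormedSpace ℝ E] (hp : Continuous p) (hp0 : ∀ s, 0 ≤ p s) (hR : ∀ s, R ≤ s → p s = 0)
    {F : E → ℝ} (hF : ContDiff ℝ 2 F) (a : ι → E) {d : ι → ℝ} (hd : ∀ i, 0 < d i)
    (hpos : ∀ x, 0 ≤ ∑ i, (d i - 1) * fderiv ℝ (fderiv ℝ F) x (a i) (a i)) :
    ∫ v : ι → ℝ, F (∑ i, v i • a i) * p (sumSq v) ≤
      ∫ v : ι → ℝ, F (∑ i, (√(d i) * v i) • a i) * p (sumSq v) := by
  classical
  -- The squares of the scalings, not the scalings, move linearly from 1 to `d i`. Hence `c t i * c'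
  -- t i` is the constant `(d i - 1) / 2`, and the quadratic expression of `hpos` appears at every
  -- time `t`.
  set c : ℝ → ι → ℝ := fun t i => √(1 + t * (d i - 1)) with hc
  have hpos1 : ∀ t ∈ Set.Icc (0 : ℝ) 1, ∀ i, 0 < 1 + t * (d i - 1) := by
    intro t ht i
    have := hd i
    rcases eq_or_lt_of_le ht.2 with h | h
    · rw [h]; linarith
    · nlinarith [ht.1, ht.2, mul_nonneg ht.1 this.le]
  set c' : ℝ → ι → ℝ := fun t i => (d i - 1) / (2 * √(1 + t * (d i - 1))) with hc'
  have hder : ∀ t ∈ Set.Icc (0 : ℝ) 1, ∀ i, HasDerivAt (fun t => c t i) (c' t i) t := by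
    intro t ht i
    have h1 : HasDerivAt (fun t : ℝ => 1 + t * (d i - 1)) (d i - 1) t := by
      simpa using ((hasDerivAt_id t).mul_const (d i - 1)).const_add 1
    exact h1.sqrt (hpos1 t ht i).ne'
  have hcc : ∀ t ∈ Set.Icc (0 : ℝ) 1, ∀ i, c t i * c' t i = (d i - 1) / 2 := by
    intro t ht i
    have : √(1 + t * (d i - 1)) ≠ 0 := (Real.sqrt_pos.2 (hpos1 t ht i)).ne'
    simp only [hc, hc']; field_simp
  have hccont : ∀ i, Continuous fun t => c t i := fun i => by simp only [hc]; fun_prop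
  have hc'cont : ∀ i, ContinuousOn (fun t => c' t i) (Set.Icc 0 1) := by
    intro i
    refine continuousOn_const.div (by fun_prop) fun t ht => ?_
    have := (Real.sqrt_pos.2 (hpos1 t ht i)).ne'
    positivity
  set L : ℝ → (ι → ℝ) → E := fun t v => ∑ i, (c t i * v i) • a i with hL
  set φ : ℝ → (ι → ℝ) → ℝ := fun t v => F (L t v) * p (sumSq v) with hφ
  set φ' : ℝ → (ι → ℝ) → ℝ := fun t v =>
    fderiv ℝ F (L t v) (∑ i, (c' t i * v i) • a i) * p (sumSq v) with hφ'
  have hLcont : Continuous (Function.uncurry L) := by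
    refine continuous_finsetSum _ fun i _ => ?_
    exact (((hccont i).comp continuous_fst).mul
      ((continuous_apply i).comp continuous_snd)).smul continuous_const
  have hpc : Continuous fun v : ι → ℝ => p (sumSq v) := hp.comp continuous_sumSq
  have hF1 : ContDiff ℝ 1 (fderiv ℝ F) := hF.fderiv_right (by norm_num)
  have hφcont : Continuous (Function.uncurry φ) :=
    (hF.continuous.comp hLcont).mul (hpc.comp continuous_snd)
  have hφ'cont : ContinuousOn (Function.uncurry φ') (Set.Icc 0 1 ×ˢ Set.univ) := by
    refine ContinuousOn.mul (ContinuousOn.clm_apply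
      (hF1.continuous.comp hLcont).continuousOn ?_) (hpc.comp continuous_snd).continuousOn
    refine continuousOn_finsetSum _ fun i _ => ?_
    refine ContinuousOn.smul (ContinuousOn.mul ?_ ?_) continuousOn_const
    · exact (hc'cont i).comp continuousOn_fst fun x hx => hx.1
    · exact ((continuous_apply i).comp continuous_snd).continuousOn
  obtain ⟨C, hC⟩ := (isCompact_Icc.prod (isCompact_sumSq_le (ι := ι) R)).exists_bound_of_continuousOn
    (hφ'cont.mono (Set.prod_mono_right (Set.subset_univ _)))
  have hderφ : ∀ t ∈ Set.Icc (0 : ℝ) 1, ∀ v, HasDerivAt (fun t => φ t v) (φ' t v) t := by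
    intro t ht v
    have h1 : HasDerivAt (fun t => L t v) (∑ i, (c' t i * v i) • a i) t :=
      HasDerivAt.fun_sum fun i _ => ((hder t ht i).mul_const (v i)).smul_const (a i)
    have h2 := (hF.differentiable (by simp) (L t v)).hasFDerivAt.comp_hasDerivAt t h1
    exact h2.mul_const _
  have hφt : ∀ t, Continuous (φ t) := fun t => hφcont.comp (continuous_const.prodMk continuous_id)
  have hLt : ∀ t, Continuous (L t) := fun t => hLcont.comp (continuous_const.prodMk continuous_id)
  have hint : ∀ t ∈ Set.Ioo (0 : ℝ) 1,
      HasDerivAt (fun t => ∫ v, φ t v) (∫ v, φ' t v) t := by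
    intro t ht
    refine (hasDerivAt_integral_of_dominated_loc_of_deriv_le (μ := volume) (F := φ) (F' := φ')
      (bound := fun v => Set.indicator {v : ι → ℝ | sumSq v ≤ R} (fun _ => C) v)
      (Icc_mem_nhds ht.1 ht.2)
      (Eventually.of_forall fun s => (hφt s).aestronglyMeasurable)
      (integrable_mul_radial hp hR (h := fun v => F (L t v)) (hF.continuous.comp (hLt t)))
      ?_ ?_ ?_ (Eventually.of_forall fun v s hs => hderφ s hs v)).2
    · have : Continuous fun v => Function.uncurry φ' (t, v) :=
        hφ'cont.comp_continuous (by fun_prop) fun v => ⟨⟨ht.1.le, ht.2.le⟩, trivial⟩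
      exact this.aestronglyMeasurable
    · refine Eventually.of_forall fun v s hs => ?_
      by_cases hv : v ∈ {v : ι → ℝ | sumSq v ≤ R}
      · rw [Set.indicator_of_mem hv]
        exact hC (s, v) ⟨hs, hv⟩
      · rw [Set.indicator_of_notMem hv]
        simp only [hφ', radial_eq_zero hR hv, mul_zero, norm_zero, le_refl]
    · exact (integrable_indicator_iff (isCompact_sumSq_le R).measurableSet).2
        (integrableOn_const (isCompact_sumSq_le R).measure_lt_top.ne)
  have hcontI : ContinuousOn (fun t => ∫ v, φ t v) (Set.Icc 0 1) :=
    continuousOn_integral_of_compact_support (isCompact_sumSq_le R) hφcont.continuousOn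
      fun t v _ hv => by simp only [hφ, radial_eq_zero hR hv, mul_zero]
  have hnonneg : ∀ t ∈ Set.Ioo (0 : ℝ) 1, 0 ≤ ∫ v, φ' t v := by
    intro t ht
    have htI : t ∈ Set.Icc (0 : ℝ) 1 := ⟨ht.1.le, ht.2.le⟩
    have hLd : ∀ v, HasFDerivAt (L t) (∑ i, (c t i • ContinuousLinearMap.proj (R := ℝ)
        (φ := fun _ : ι => ℝ) i).smulRight (a i)) v := by
      intro v
      refine HasFDerivAt.fun_sum fun i _ => ?_
      exact (((ContinuousLinearMap.proj (R := ℝ) (φ := fun _ : ι => ℝ) i).hasFDerivAt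
        (x := v)).const_smul (c t i)).smul_const (a i)
    have hLsm : ContDiff ℝ 1 (L t) := by
      refine ContDiff.sum fun i _ => ?_
      exact (contDiff_const.mul (contDiff_apply ℝ ℝ i)).smul contDiff_const
    set h : ι → (ι → ℝ) → ℝ := fun i v => fderiv ℝ F (L t v) (a i) with hh
    have hhs : ∀ i, ContDiff ℝ 1 (h i) := fun i => (hF1.comp hLsm).clm_apply contDiff_const
    have hhd : ∀ i v, fderiv ℝ (h i) v (Pi.single i 1) =
        c t i * fderiv ℝ (fderiv ℝ F) (L t v) (a i) (a i) := by
      intro i v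
      have h1 := ((hF1.differentiable (by simp) (L t v)).hasFDerivAt.comp v (hLd v)).clm_apply
        (hasFDerivAt_const (a i) v)
      have h2 : fderiv ℝ (h i) v = _ := h1.fderiv
      rw [h2]
      simp [Pi.single_apply, ite_smul]
    have e1 : ∫ v, φ' t v = ∑ i, c' t i * ∫ v, v i * h i v * p (sumSq v) := by
      simp_rw [← integral_const_mul]
      rw [← integral_finsetSum]
      · refine integral_congr_ae (Eventually.of_forall fun v => ?_)
        simp only [hφ', hh, map_sum, map_smul, smul_eq_mul, Finset.sum_mul]
        exact Finset.sum_congr rfl fun i _ => by ring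
      · intro i _
        exact (integrable_mul_radial hp hR
          ((continuous_apply i).mul (hhs i).continuous)).const_mul _
    -- Stein's identity trades each factor `v i` for a derivative along the `i`-th axis, which
    -- releases a factor `c t i` to pair with `c' t i`.
    have e2 : ∫ v, φ' t v = ∫ v, (∑ i, (d i - 1) * fderiv ℝ (fderiv ℝ F) (L t v) (a i) (a i)) *
        (halfTail p R (sumSq v) / 2) := by
      rw [e1]
      simp_rw [integral_coord_mul_radial hp hR (hhs _), hhd, ← integral_const_mul]
      rw [← integral_finsetSum]
      · refine integral_congr_ae (Eventually.of_forall fun v => ?_)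
        simp only [Finset.sum_mul]
        refine Finset.sum_congr rfl fun i _ => ?_
        have := hcc t htI i
        calc _ = (c t i * c' t i) * (fderiv ℝ (fderiv ℝ F) (L t v) (a i) (a i) *
              halfTail p R (sumSq v)) := by ring
          _ = _ := by rw [this]; ring
      · intro i _
        refine (integrable_mul_radial (continuous_halfTail hp)
          (fun s => halfTail_eq_zero hR) ?_).const_mul _
        refine continuous_const.mul ?_
        exact ((((hF1.continuous_fderiv (by simp)).comp (hLt t)).clm_apply
          continuous_const).clm_apply continuous_const)
    rw [e2]
    refine integral_nonneg fun v => ?_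
    have := halfTail_nonneg hp0 hR (sumSq v)
    exact mul_nonneg (hpos _) (by positivity)
  have hmono := monotoneOn_of_deriv_nonneg (convex_Icc (0 : ℝ) 1) hcontI
    (fun t ht => ((hint t (by rwa [interior_Icc] at ht)).differentiableAt).differentiableWithinAt)
    (fun t ht => by
      rw [interior_Icc] at ht
      rw [(hint t ht).deriv]; exact hnonneg t ht)
  have := hmono (Set.left_mem_Icc.2 zero_le_one) (Set.right_mem_Icc.2 zero_le_one) zero_le_one
  simpa [hφ, hL, hc] using this

end Path

/-! ### Rotation invariance and comparison of two scale matrices -/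

section Orthogonal

variable {ι : Type*} [Fintype ι]

lemma sumSq_eq_dotProduct (v : ι → ℝ) : sumSq v = v ⬝ᵥ v := by
  simp [sumSq, dotProduct, sq]

lemma measurable_mulVec (M : Matrix ι ι ℝ) : Measurable fun v : ι → ℝ => M *ᵥ v :=
  (Continuous.matrix_mulVec continuous_const continuous_id).measurable

variable [DecidableEq ι]

lemma sumSq_mulVec {O : Matrix ι ι ℝ} (hO : Oᵀ * O = 1) (v : ι → ℝ) :
    sumSq (O *ᵥ v) = sumSq v := by
  rw [sumSq_eq_dotProduct, sumSq_eq_dotProduct, dotProduct_mulVec, ← mulVec_transpose,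
    mulVec_mulVec, hO, one_mulVec]

lemma map_mulVec_volume {M : Matrix ι ι ℝ} (hM : M.det ≠ 0) :
    Measure.map (fun v : ι → ℝ => M *ᵥ v) volume = ENNReal.ofReal |M.det⁻¹| • volume :=
  Real.map_matrix_volume_pi_eq_smul_volume_pi hM

lemma abs_det_of_orthogonal {O : Matrix ι ι ℝ} (hO : Oᵀ * O = 1) : |O.det| = 1 := by
  have h : O.det * O.det = 1 := by
    have := congrArg Matrix.det hO
    simpa using this
  rcases mul_self_eq_one_iff.1 h with h | h <;> simp [h]

lemma measurePreserving_mulVec {O : Matrix ι ι ℝ} (hO : Oᵀ * O = 1) :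
    MeasurePreserving (fun v : ι → ℝ => O *ᵥ v) := by
  refine ⟨measurable_mulVec O, ?_⟩
  have h1 := abs_det_of_orthogonal hO
  have : O.det ≠ 0 := by
    intro h; rw [h] at h1; simp at h1
  rw [map_mulVec_volume this, abs_inv, h1]
  simp

lemma integral_mulVec_radial {O : Matrix ι ι ℝ} (hO : Oᵀ * O = 1) (p : ℝ → ℝ)
    {h : (ι → ℝ) → ℝ} (hh : Measurable h) (hp : Measurable p) :
    ∫ v, h (O *ᵥ v) * p (sumSq v) = ∫ v, h v * p (sumSq v) := by
  have hm := measurePreserving_mulVec hO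
  have h1 : Measurable fun v : ι → ℝ => h v * p (sumSq v) :=
    hh.mul (hp.comp continuous_sumSq.measurable)
  conv_rhs => rw [← hm.map_eq]
  rw [integral_map hm.aemeasurable h1.aestronglyMeasurable]
  simp only [sumSq_mulVec hO]

/-- Simultaneous diagonalization of `M Mᵀ` and `N Nᵀ`. -/
lemma exists_simultaneous_diagonalization {M N : Matrix ι ι ℝ} (hM : M.det ≠ 0) (hN : N.det ≠ 0) :
    ∃ (A O O' : Matrix ι ι ℝ) (d : ι → ℝ), (∀ i, 0 < d i) ∧ Oᵀ * O = 1 ∧ O'ᵀ * O' = 1 ∧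
      M = A * O ∧ N = A * diagonal (fun i => √(d i)) * O' := by
  have hMu : IsUnit M.det := hM.isUnit
  have hNu : IsUnit N.det := hN.isUnit
  set T := M⁻¹ * N with hT
  have hTu : IsUnit T := by
    rw [hT, Matrix.isUnit_iff_isUnit_det, det_mul]
    exact (M.isUnit_nonsing_inv_det hMu).mul hNu
  have hpd : (T * Tᵀ).PosDef := by
    have := Matrix.PosDef.mul_conjTranspose_self T (Matrix.vecMul_injective_iff_isUnit.2 hTu)
    simpa using this
  set d := hpd.isHermitian.eigenvalues
  set Q : Matrix ι ι ℝ := (hpd.isHermitian.eigenvectorUnitary : Matrix ι ι ℝ) with hQ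
  have hd : ∀ i, 0 < d i := hpd.eigenvalues_pos
  have hQ1 : Qᵀ * Q = 1 := by
    have := Unitary.coe_star_mul_self hpd.isHermitian.eigenvectorUnitary
    simpa [star_eq_conjTranspose] using this
  have hQ2 : Q * Qᵀ = 1 := mul_eq_one_comm.1 hQ1
  have hsp : T * Tᵀ = Q * diagonal d * Qᵀ := by
    have := hpd.isHermitian.spectral_theorem
    rw [Unitary.conjStarAlgAut_apply] at this
    simpa [star_eq_conjTranspose, Function.comp_def] using this
  have hsq : ∀ i, √(d i) ≠ 0 := fun i => (Real.sqrt_pos.2 (hd i)).ne'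
  set D : Matrix ι ι ℝ := diagonal fun i => √(d i)
  set D' : Matrix ι ι ℝ := diagonal fun i => (√(d i))⁻¹
  have hDD : D * D' = 1 := by
    simp [D, D', diagonal_mul_diagonal, hsq]
  have hD'D : D' * D = 1 := mul_eq_one_comm.1 hDD
  have hdD : diagonal d = D * D := by
    simp [D, diagonal_mul_diagonal, Real.mul_self_sqrt (hd _).le]
  -- From T Tᵀ = Q D² Qᵀ, the matrix D⁻¹ Qᵀ T is orthogonal; inserting Q D D⁻¹ Qᵀ = 1 into N = M T
  -- gives the factorization with A = M Q.
  refine ⟨M * Q, Qᵀ, D' * Qᵀ * T, d, hd, by simpa using hQ2, ?_, ?_, ?_⟩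
  · rw [mul_eq_one_comm]
    have hDt : D'ᵀ = D' := diagonal_transpose _
    calc D' * Qᵀ * T * (D' * Qᵀ * T)ᵀ = D' * Qᵀ * (T * Tᵀ) * Q * D' := by
          simp only [transpose_mul, transpose_transpose, hDt, Matrix.mul_assoc]
      _ = D' * (Qᵀ * Q) * (D * D) * (Qᵀ * Q) * D' := by
          rw [hsp, hdD]; simp only [Matrix.mul_assoc]
      _ = (D' * D) * (D * D') := by
          rw [hQ1]; simp only [Matrix.mul_assoc, Matrix.mul_one]
      _ = 1 := by rw [hDD, hD'D, Matrix.mul_one]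
  · rw [Matrix.mul_assoc, hQ2, Matrix.mul_one]
  · calc N = M * T := by rw [hT, ← Matrix.mul_assoc, Matrix.mul_nonsing_inv _ hMu, Matrix.one_mul]
      _ = M * (Q * (D * D') * Qᵀ) * T := by rw [hDD, Matrix.mul_one, hQ2, Matrix.mul_one]
      _ = _ := by simp only [Matrix.mul_assoc, D]

lemma bilin_sum_eq (B : (ι → ℝ) →L[ℝ] (ι → ℝ) →L[ℝ] ℝ) (x y : ι → ℝ) :
    B x y = ∑ j, ∑ k, x j * y k * B (Pi.single j 1) (Pi.single k 1) := by
  conv_lhs => rw [← Finset.univ_sum_single x, ← Finset.univ_sum_single y]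
  have h : ∀ (z : ι → ℝ) i, (Pi.single i (z i) : ι → ℝ) = z i • Pi.single i 1 := by
    intro z i; rw [← Pi.single_smul]; simp
  simp only [h, map_sum, map_smul, _root_.sum_apply, _root_.smul_apply, smul_eq_mul,
    Finset.mul_sum]
  rw [Finset.sum_comm]
  exact Finset.sum_congr rfl fun j _ => Finset.sum_congr rfl fun k _ => by ring

/-- If `F` is `C²` and `∑ⱼₖ (N Nᵀ - M Mᵀ)ⱼₖ ∂ⱼ∂ₖF ≥ 0`, then the radial average of `F` is larger
along `N` than along `M`. -/
lemma integral_radial_le_of_scale {p : ℝ → ℝ} {R : ℝ}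
    (hp : Continuous p) (hp0 : ∀ s, 0 ≤ p s) (hR : ∀ s, R ≤ s → p s = 0)
    {F : (ι → ℝ) → ℝ} (hF : ContDiff ℝ 2 F) {M N : Matrix ι ι ℝ} (hM : M.det ≠ 0)
    (hN : N.det ≠ 0)
    (hpos : ∀ x, 0 ≤ ∑ j, ∑ k, (N * Nᵀ - M * Mᵀ) j k *
      fderiv ℝ (fderiv ℝ F) x (Pi.single j 1) (Pi.single k 1)) :
    ∫ v, F (M *ᵥ v) * p (sumSq v) ≤ ∫ v, F (N *ᵥ v) * p (sumSq v) := by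
  obtain ⟨A, O, O', d, hd, hO, hO', rfl, rfl⟩ := exists_simultaneous_diagonalization hM hN
  have hOt : O * Oᵀ = 1 := mul_eq_one_comm.1 hO
  have hOt' : O' * O'ᵀ = 1 := mul_eq_one_comm.1 hO'
  have hmeas : ∀ C : Matrix ι ι ℝ, Measurable fun v => F (C *ᵥ v) := fun C =>
    hF.continuous.measurable.comp (measurable_mulVec C)
  have e1 := integral_mulVec_radial hO p (hmeas A) hp.measurable
  have e2 := integral_mulVec_radial hO' p (hmeas (A * diagonal fun i => √(d i))) hp.measurable
  simp only [mulVec_mulVec] at e1 e2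
  rw [e1, e2]
  have hA : ∀ v, A *ᵥ v = ∑ i, v i • fun j => A j i := by
    intro v; ext j; simp [mulVec, dotProduct, Finset.sum_apply, mul_comm]
  have hA' : ∀ v, (A * diagonal fun i => √(d i)) *ᵥ v = ∑ i, (√(d i) * v i) • fun j => A j i := by
    intro v
    rw [← mulVec_mulVec, hA]
    simp [mulVec_diagonal]
  simp only [hA, hA']
  refine integral_radial_le_of_axes hp hp0 hR hF (fun i j => A j i) hd fun x => ?_
  refine (hpos x).trans_eq ?_
  -- The orthogonal factors cancel and N Nᵀ - M Mᵀ = A diag(d - 1) Aᵀ, so `hpos` is the condition on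
  -- the axes given by the columns of A.
  have hdiff : ∀ j k, (A * diagonal (fun i => √(d i)) * O' * (A * diagonal (fun i => √(d i)) * O')ᵀ -
      A * O * (A * O)ᵀ) j k = ∑ i, (d i - 1) * (A j i * A k i) := by
    intro j k
    have h1 : A * diagonal (fun i => √(d i)) * O' * (A * diagonal (fun i => √(d i)) * O')ᵀ =
        A * diagonal d * Aᵀ := by
      calc _ = A * diagonal (fun i => √(d i)) * (O' * O'ᵀ) * diagonal (fun i => √(d i)) * Aᵀ := by
            simp only [transpose_mul, diagonal_transpose, Matrix.mul_assoc]
        _ = A * (diagonal (fun i => √(d i)) * diagonal (fun i => √(d i))) * Aᵀ := by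
            rw [hOt', Matrix.mul_one]; simp only [Matrix.mul_assoc]
        _ = _ := by simp [diagonal_mul_diagonal, Real.mul_self_sqrt (hd _).le]
    have h2 : A * O * (A * O)ᵀ = A * Aᵀ := by
      calc _ = A * (O * Oᵀ) * Aᵀ := by simp only [transpose_mul, Matrix.mul_assoc]
        _ = _ := by rw [hOt, Matrix.mul_one]
    rw [h1, h2, Matrix.sub_apply, mul_apply, mul_apply, ← Finset.sum_sub_distrib]
    refine Finset.sum_congr rfl fun i _ => ?_
    rw [mul_diagonal, transpose_apply]; ring
  simp only [hdiff]
  conv_rhs => enter [2, i]; rw [bilin_sum_eq]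
  simp only [Finset.sum_mul, Finset.mul_sum]
  rw [Finset.sum_comm (γ := ι) (s := Finset.univ) (t := Finset.univ)]
  conv_rhs => rw [Finset.sum_comm]; enter [2, j]; rw [Finset.sum_comm]
  rw [Finset.sum_comm]
  refine Finset.sum_congr rfl fun j _ => Finset.sum_congr rfl fun k _ => ?_
  exact Finset.sum_congr rfl fun i _ => by ring

end Orthogonal

/-! ### Comparison over a half-space for C² functions -/

section HalfSpace

variable {n : ℕ}

/-- The linear map `(w, z) ↦ (w, δ w + K z)`. -/
def skewMatrix (δ : Fin n → ℝ) (K : Matrix (Fin n) (Fin n) ℝ) :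
    Matrix (Unit ⊕ Fin n) (Unit ⊕ Fin n) ℝ :=
  fromBlocks 1 0 (of fun i _ => δ i) K

lemma skewMatrix_mulVec_inl (δ : Fin n → ℝ) (K : Matrix (Fin n) (Fin n) ℝ)
    (v : Unit ⊕ Fin n → ℝ) : (skewMatrix δ K *ᵥ v) (Sum.inl ()) = v (Sum.inl ()) := by
  simp [skewMatrix, mulVec, dotProduct, Fintype.sum_sum_type]

lemma skewMatrix_mulVec_inr (δ : Fin n → ℝ) (K : Matrix (Fin n) (Fin n) ℝ)
    (v : Unit ⊕ Fin n → ℝ) (i : Fin n) : (skewMatrix δ K *ᵥ v) (Sum.inr i) =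
      δ i * v (Sum.inl ()) + (K *ᵥ (v ∘ Sum.inr)) i := by
  simp [skewMatrix, mulVec, dotProduct, Fintype.sum_sum_type]

lemma det_skewMatrix (δ : Fin n → ℝ) (K : Matrix (Fin n) (Fin n) ℝ) :
    (skewMatrix δ K).det = K.det := by
  simp [skewMatrix, det_fromBlocks_zero₁₂]

/-- The first diagonal block is 1 for every `δ` and `K`, so two such scale matrices differ only in
the cross blocks and in the last block. -/
lemma skewMatrix_mul_transpose (δ : Fin n → ℝ) (K : Matrix (Fin n) (Fin n) ℝ) :
    skewMatrix δ K * (skewMatrix δ K)ᵀ =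
      fromBlocks 1 (of fun _ i => δ i) (of fun i _ => δ i) (vecMulVec δ δ + K * Kᵀ) := by
  rw [skewMatrix, fromBlocks_transpose, fromBlocks_multiply]
  congr 1
  · simp
  · ext; simp
  · ext; simp
  · ext i j; simp [mul_apply, vecMulVec_apply]

/-- The coordinate `w` of `(w, z)`. -/
def fstCLM (n : ℕ) : (Unit ⊕ Fin n → ℝ) →L[ℝ] ℝ := ContinuousLinearMap.proj (Sum.inl ())

/-- The coordinates `z` of `(w, z)`. -/
def sndCLM (n : ℕ) : (Unit ⊕ Fin n → ℝ) →L[ℝ] (Fin n → ℝ) :=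
  ContinuousLinearMap.pi fun i => ContinuousLinearMap.proj (Sum.inr i)

@[simp] lemma fstCLM_apply (v : Unit ⊕ Fin n → ℝ) : fstCLM n v = v (Sum.inl ()) := rfl

@[simp] lemma sndCLM_apply (v : Unit ⊕ Fin n → ℝ) (i : Fin n) : sndCLM n v i = v (Sum.inr i) := rfl

/-- Second derivative of `χ (w) f (z)`. -/
lemma fderiv_fderiv_mul_comp {E E₁ : Type*} [NormedAddCommGroup E] [NormedSpace ℝ E]
    [NormedAddCommGroup E₁] [NormedSpace ℝ E₁] {χ : ℝ → ℝ} {f : E₁ → ℝ} (hχ : ContDiff ℝ 2 χ)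
    (hf : ContDiff ℝ 2 f) (W : E →L[ℝ] ℝ) (Z : E →L[ℝ] E₁) (x a b : E) :
    fderiv ℝ (fderiv ℝ fun x => χ (W x) * f (Z x)) x a b =
      χ (W x) * fderiv ℝ (fderiv ℝ f) (Z x) (Z a) (Z b) +
      deriv χ (W x) * (W a * fderiv ℝ f (Z x) (Z b) + W b * fderiv ℝ f (Z x) (Z a)) +
      deriv (deriv χ) (W x) * W a * W b * f (Z x) := by
  have hχd : ∀ t, HasDerivAt χ (deriv χ t) t := fun t =>
    (hχ.differentiable (by simp) t).hasDerivAt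
  have hχ1 : ContDiff ℝ 1 (deriv χ) := by
    have := hχ.iterate_deriv' 1 1
    simpa using this
  have hχdd : ∀ t, HasDerivAt (deriv χ) (deriv (deriv χ) t) t := fun t =>
    (hχ1.differentiable (by simp) t).hasDerivAt
  have hf1 : ContDiff ℝ 1 (fderiv ℝ f) := hf.fderiv_right (by norm_num)
  have hfd : ∀ z, HasFDerivAt f (fderiv ℝ f z) z := fun z =>
    (hf.differentiable (by simp) z).hasFDerivAt
  have hfdd : ∀ z, HasFDerivAt (fderiv ℝ f) (fderiv ℝ (fderiv ℝ f) z) z := fun z =>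
    (hf1.differentiable (by simp) z).hasFDerivAt
  set F : E → ℝ := fun x => χ (W x) * f (Z x) with hFdef
  have hF : ContDiff ℝ 2 F := (hχ.comp W.contDiff).mul (hf.comp Z.contDiff)
  have hF1 : ContDiff ℝ 1 (fderiv ℝ F) := hF.fderiv_right (by norm_num)
  have d1 : ∀ x, HasFDerivAt (fun x => χ (W x)) (deriv χ (W x) • W) x := fun x =>
    (hχd (W x)).comp_hasFDerivAt x W.hasFDerivAt
  have d2 : ∀ x, HasFDerivAt (fun x => deriv χ (W x)) (deriv (deriv χ) (W x) • W) x := fun x =>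
    (hχdd (W x)).comp_hasFDerivAt x W.hasFDerivAt
  have d3 : ∀ x, HasFDerivAt (fun x => f (Z x)) ((fderiv ℝ f (Z x)).comp Z) x := fun x =>
    (hfd (Z x)).comp x Z.hasFDerivAt
  have d4 : HasFDerivAt (fun x => fderiv ℝ f (Z x)) ((fderiv ℝ (fderiv ℝ f) (Z x)).comp Z) x :=
    (hfdd (Z x)).comp x Z.hasFDerivAt
  have d5 := d4.clm_apply (hasFDerivAt_const (Z b) x)
  have e1 : ∀ x, fderiv ℝ F x b = χ (W x) * fderiv ℝ f (Z x) (Z b) +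
      f (Z x) * (deriv χ (W x) * W b) := by
    intro x
    have h : fderiv ℝ F x = _ := ((d1 x).mul (d3 x)).fderiv
    rw [h]
    simp
  have e2 : HasFDerivAt (fun x => fderiv ℝ F x b)
      ((fderiv ℝ (fderiv ℝ F) x).flip b) x := by
    have := ((hF1.differentiable (by simp) x).hasFDerivAt).clm_apply (hasFDerivAt_const b x)
    refine this.congr_fderiv ?_
    ext; simp
  have e3 := ((d1 x).mul d5).add ((d3 x).mul ((d2 x).mul_const (W b)))
  have e4 : HasFDerivAt (fun x => fderiv ℝ F x b) _ x :=
    e3.congr_of_eventuallyEq (Eventually.of_forall fun x => by simp [e1 x])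
  have := congrArg (fun T : E →L[ℝ] ℝ => T a) (e2.unique e4)
  simp only [ContinuousLinearMap.flip_apply] at this
  rw [this]
  simp
  ring

variable {p : ℝ → ℝ} {R : ℝ}

/-- This is where the order of the skewness vectors is used: the cross blocks of the scale matrices
differ by δy - δx, and they are paired with χ' ∇f ≥ 0. -/
lemma integral_cutoff_le (hp : Continuous p) (hp0 : ∀ s, 0 ≤ p s) (hR : ∀ s, R ≤ s → p s = 0)
    {χ : ℝ → ℝ} (hχ : ContDiff ℝ 2 χ) (hχ0 : ∀ t, 0 ≤ χ t) (hχm : Monotone χ)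
    {f : (Fin n → ℝ) → ℝ} (hf : ContDiff ℝ 2 f) {δx δy : Fin n → ℝ}
    {Kx Ky Ωx Ωy : Matrix (Fin n) (Fin n) ℝ} (hdx : Kx.det ≠ 0) (hdy : Ky.det ≠ 0)
    (hΩx : vecMulVec δx δx + Kx * Kxᵀ = Ωx) (hΩy : vecMulVec δy δy + Ky * Kyᵀ = Ωy)
    (hδ : δx ≤ δy) (hgrad : ∀ z i, 0 ≤ fderiv ℝ f z (Pi.single i 1))
    (hpos : ∀ z, 0 ≤ ∑ i, ∑ j, (Ωy - Ωx) i j *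
      fderiv ℝ (fderiv ℝ f) z (Pi.single i 1) (Pi.single j 1)) :
    ∫ v, χ (v (Sum.inl ())) * f (sndCLM n (skewMatrix δx Kx *ᵥ v)) * p (sumSq v) ≤
      ∫ v, χ (v (Sum.inl ())) * f (sndCLM n (skewMatrix δy Ky *ᵥ v)) * p (sumSq v) := by
  have h := integral_radial_le_of_scale hp hp0 hR (M := skewMatrix δx Kx) (N := skewMatrix δy Ky)
    (F := fun x => χ (fstCLM n x) * f (sndCLM n x))
    ((hχ.comp (fstCLM n).contDiff).mul (hf.comp (sndCLM n).contDiff))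
    (by rwa [det_skewMatrix]) (by rwa [det_skewMatrix]) ?_
  · simpa [skewMatrix_mulVec_inl] using h
  · intro x
    have s1 : sndCLM n (Pi.single (Sum.inl ()) 1) = 0 := by ext i; simp
    have s2 : ∀ i, sndCLM n (Pi.single (Sum.inr i) 1) = Pi.single i 1 := by
      intro i; ext j; simp [Pi.single_apply]
    have hχ' : 0 ≤ deriv χ (x (Sum.inl ())) := hχm.deriv_nonneg
    simp only [skewMatrix_mul_transpose, hΩx, hΩy,
      fderiv_fderiv_mul_comp hχ hf (fstCLM n) (sndCLM n)]
    simp only [Fintype.sum_sum_type, s1, s2, Finset.univ_unique, Finset.sum_singleton,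
      fstCLM_apply]
    -- The ww entry of the difference is 1 - 1 = 0, which removes the term with χ'' f, whose sign is
    -- unknown. Two equal cross sums and the Hessian term remain.
    simp
    have e : ∀ q : ℝ, 0 ≤ q → 0 ≤ ∑ i, (δy i - δx i) * (q * fderiv ℝ f (sndCLM n x)
        (Pi.single i 1)) := fun q hq => Finset.sum_nonneg fun i _ =>
      mul_nonneg (sub_nonneg.2 (hδ i)) (mul_nonneg hq (hgrad _ i))
    have e2 := mul_nonneg (hχ0 (x (Sum.inl ()))) (hpos (sndCLM n x))
    rw [Finset.sum_add_distrib]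
    refine add_nonneg (e _ hχ') (add_nonneg (e _ hχ') (e2.trans_eq ?_))
    simp only [Finset.mul_sum, Matrix.sub_apply]
    exact Finset.sum_congr rfl fun i _ => Finset.sum_congr rfl fun j _ => by ring

/-- The indicator function of `(0, ∞)`. -/
def posStep (t : ℝ) : ℝ := if 0 < t then 1 else 0

lemma measurable_posStep : Measurable posStep :=
  Measurable.ite measurableSet_Ioi measurable_const measurable_const

lemma abs_posStep_le (t : ℝ) : |posStep t| ≤ 1 := by
  unfold posStep; split_ifs <;> simp

lemma tendsto_smoothTransition_posStep (t : ℝ) :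
    Tendsto (fun k : ℕ => Real.smoothTransition (k * t)) atTop (𝓝 (posStep t)) := by
  unfold posStep
  split_ifs with h
  · obtain ⟨N, hN⟩ := exists_nat_gt (1 / t)
    refine tendsto_const_nhds.congr' ?_
    filter_upwards [eventually_ge_atTop N] with k hk
    have : (N : ℝ) ≤ k := by exact_mod_cast hk
    rw [Real.smoothTransition.one_of_one_le]
    rw [div_lt_iff₀ h] at hN
    nlinarith
  · refine tendsto_const_nhds.congr fun k => ?_
    rw [Real.smoothTransition.zero_of_nonpos]
    exact mul_nonpos_of_nonneg_of_nonpos (Nat.cast_nonneg k) (not_lt.1 h)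

lemma continuous_snd_skewMatrix (δ : Fin n → ℝ) (K : Matrix (Fin n) (Fin n) ℝ) :
    Continuous fun v => sndCLM n (skewMatrix δ K *ᵥ v) :=
  (sndCLM n).continuous.comp (Continuous.matrix_mulVec continuous_const continuous_id)

lemma tendsto_integral_cutoff (hp : Continuous p) (hR : ∀ s, R ≤ s → p s = 0)
    {h : (Unit ⊕ Fin n → ℝ) → ℝ} (hh : Continuous h) :
    Tendsto (fun k : ℕ => ∫ v, Real.smoothTransition (k * v (Sum.inl ())) * h v * p (sumSq v))
      atTop (𝓝 (∫ v, posStep (v (Sum.inl ())) * h v * p (sumSq v))) := by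
  refine tendsto_integral_of_dominated_convergence (fun v => |h v * p (sumSq v)|) (fun k => ?_)
    (integrable_mul_radial hp hR hh).abs (fun k => Eventually.of_forall fun v => ?_)
    (Eventually.of_forall fun v => ?_)
  · have : Continuous fun v : Unit ⊕ Fin n → ℝ => Real.smoothTransition (k * v (Sum.inl ())) :=
      Real.smoothTransition.continuous.comp (by fun_prop)
    exact ((this.mul hh).mul (hp.comp continuous_sumSq)).aestronglyMeasurable
  · rw [mul_assoc, norm_mul, Real.norm_eq_abs, Real.norm_eq_abs]
    refine mul_le_of_le_one_left (abs_nonneg _) ?_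
    rw [abs_of_nonneg (Real.smoothTransition.nonneg _)]
    exact Real.smoothTransition.le_one _
  · exact ((tendsto_smoothTransition_posStep _).mul_const _).mul_const _

lemma integral_posStep_le_of_contDiff (hp : Continuous p) (hp0 : ∀ s, 0 ≤ p s)
    (hR : ∀ s, R ≤ s → p s = 0)
    {f : (Fin n → ℝ) → ℝ} (hf : ContDiff ℝ 2 f) {δx δy : Fin n → ℝ}
    {Kx Ky Ωx Ωy : Matrix (Fin n) (Fin n) ℝ} (hdx : Kx.det ≠ 0) (hdy : Ky.det ≠ 0)
    (hΩx : vecMulVec δx δx + Kx * Kxᵀ = Ωx) (hΩy : vecMulVec δy δy + Ky * Kyᵀ = Ωy)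
    (hδ : δx ≤ δy) (hgrad : ∀ z i, 0 ≤ fderiv ℝ f z (Pi.single i 1))
    (hpos : ∀ z, 0 ≤ ∑ i, ∑ j, (Ωy - Ωx) i j *
      fderiv ℝ (fderiv ℝ f) z (Pi.single i 1) (Pi.single j 1)) :
    ∫ v, posStep (v (Sum.inl ())) * f (sndCLM n (skewMatrix δx Kx *ᵥ v)) * p (sumSq v) ≤
      ∫ v, posStep (v (Sum.inl ())) * f (sndCLM n (skewMatrix δy Ky *ᵥ v)) * p (sumSq v) := by
  refine le_of_tendsto_of_tendsto'
    (tendsto_integral_cutoff hp hR (hf.continuous.comp (continuous_snd_skewMatrix δx Kx)))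
    (tendsto_integral_cutoff hp hR (hf.continuous.comp (continuous_snd_skewMatrix δy Ky)))
    fun k => ?_
  refine integral_cutoff_le hp hp0 hR (χ := fun t => Real.smoothTransition (k * t))
    (Real.smoothTransition.contDiff.comp (contDiff_const.mul contDiff_id))
    (fun t => Real.smoothTransition.nonneg _) (fun s t hst => Real.smoothTransition.monotone ?_)
    hf hdx hdy hΩx hΩy hδ hgrad hpos
  exact mul_le_mul_of_nonneg_left hst (Nat.cast_nonneg k)

end HalfSpace

/-! ### Second differences -/

section SecondDifference

variable {E : Type*} [NormedAddCommGroup E] [NormedSpace ℝ E]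

/-- The second differences of `f` in the directions `u`, `v` are non-negative. -/
def SecondDiffNonneg (f : E → ℝ) (u v : E) : Prop :=
  ∀ (x : E) (s t : ℝ), 0 ≤ s → 0 ≤ t → f (x + s • u) + f (x + t • v) ≤ f (x + s • u + t • v) + f x

lemma hasDerivAt_line {f : E → ℝ} (hf : Differentiable ℝ f) (x v : E) (t : ℝ) :
    HasDerivAt (fun t : ℝ => f (x + t • v)) (fderiv ℝ f (x + t • v) v) t := by
  have h : HasDerivAt (fun t : ℝ => x + t • v) v t := by
    simpa using ((hasDerivAt_id t).smul_const v).const_add x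
  exact (hf _).hasFDerivAt.comp_hasDerivAt t h

lemma hasDerivAt_fderiv_line {f : E → ℝ} (hf : Differentiable ℝ (fderiv ℝ f)) (x u v : E) (s : ℝ) :
    HasDerivAt (fun s : ℝ => fderiv ℝ f (x + s • u) v)
      (fderiv ℝ (fderiv ℝ f) (x + s • u) u v) s := by
  have h : HasDerivAt (fun t : ℝ => x + t • u) u s := by
    simpa using ((hasDerivAt_id s).smul_const u).const_add x
  have h1 := (hf (x + s • u)).hasFDerivAt.comp_hasDerivAt s h
  have h2 := h1.clm_apply (hasDerivAt_const s v)
  simpa using h2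

/-- One-variable monotonicity is applied twice, first along `u` to the derivative in direction `v`,
then along `v` to the increment of `f`. No continuity of the second derivative is needed. -/
lemma SecondDiffNonneg.of_fderiv {f : E → ℝ} (hf : Differentiable ℝ f)
    (hf' : Differentiable ℝ (fderiv ℝ f)) {u v : E}
    (h : ∀ x, 0 ≤ fderiv ℝ (fderiv ℝ f) x u v) : SecondDiffNonneg f u v := by
  intro x s t hs ht
  have h1 : Monotone fun t : ℝ => f (x + s • u + t • v) - f (x + t • v) := by
    refine monotone_of_deriv_nonneg (fun t => ((hasDerivAt_line hf (x + s • u) v t).sub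
      (hasDerivAt_line hf x v t)).differentiableAt) fun t => ?_
    have e := ((hasDerivAt_line hf (x + s • u) v t).sub (hasDerivAt_line hf x v t)).deriv
    refine le_of_le_of_eq ?_ e.symm
    have h2 : Monotone fun s : ℝ => fderiv ℝ f (x + t • v + s • u) v := by
      refine monotone_of_deriv_nonneg
        (fun s => (hasDerivAt_fderiv_line hf' (x + t • v) u v s).differentiableAt) fun s => ?_
      rw [(hasDerivAt_fderiv_line hf' (x + t • v) u v s).deriv]
      exact h _
    have h3 := h2 hs
    simp only [zero_smul, add_zero] at h3
    rw [add_right_comm]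
    linarith
  have h4 := h1 ht
  simp only [zero_smul, add_zero] at h4
  linarith

/-- Used to recover the sign of the Hessian of a mollification from the second differences it
inherits. -/
lemma SecondDiffNonneg.fderiv_nonneg {f : E → ℝ} (hf : Differentiable ℝ f)
    (hf' : Differentiable ℝ (fderiv ℝ f)) {u v : E} (h : SecondDiffNonneg f u v) (x : E) :
    0 ≤ fderiv ℝ (fderiv ℝ f) x u v := by
  have h1 : Monotone fun s : ℝ => fderiv ℝ f (x + s • u) v := by
    intro a b hab
    have h2 : Monotone fun t : ℝ => f (x + b • u + t • v) - f (x + a • u + t • v) := by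
      intro c d hcd
      have := h (x + a • u + c • v) (b - a) (d - c) (sub_nonneg.2 hab) (sub_nonneg.2 hcd)
      have e1 : x + a • u + c • v + (b - a) • u = x + b • u + c • v := by module
      have e2 : x + a • u + c • v + (d - c) • v = x + a • u + d • v := by module
      have e3 : x + b • u + c • v + (d - c) • v = x + b • u + d • v := by module
      rw [e1, e2, e3] at this
      simp only
      linarith
    have h3 := h2.deriv_nonneg (x := 0)
    have e := ((hasDerivAt_line hf (x + b • u) v 0).sub (hasDerivAt_line hf (x + a • u) v 0)).deriv
    have h4 := h3.trans_eq e
    simp only [zero_smul, add_zero] at h4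
    simpa using h4
  have h5 := h1.deriv_nonneg (x := 0)
  rw [(hasDerivAt_fderiv_line hf' x u v 0).deriv] at h5
  simpa using h5

/-- The two middle points are convex combinations of the same two end points with the weights
exchanged; the two convexity inequalities are added. -/
lemma secondDiffNonneg_of_convexOn {f : E → ℝ} (hf : ConvexOn ℝ Set.univ f) (u : E) :
    SecondDiffNonneg f u u := by
  intro x s t hs ht
  rcases hs.eq_or_lt with rfl | hs'
  · simp [add_comm]
  have hst : 0 < s + t := by linarith
  have h1 := hf.2 (Set.mem_univ x) (Set.mem_univ (x + s • u + t • u))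
    (show 0 ≤ t / (s + t) by positivity)
    (show 0 ≤ s / (s + t) by positivity) (by field_simp; ring)
  have h2 := hf.2 (Set.mem_univ x) (Set.mem_univ (x + s • u + t • u))
    (show 0 ≤ s / (s + t) by positivity)
    (show 0 ≤ t / (s + t) by positivity) (by field_simp)
  have e1 : (t / (s + t)) • x + (s / (s + t)) • (x + s • u + t • u) = x + s • u := by
    match_scalars <;> field_simp
    ring
  have e2 : (s / (s + t)) • x + (t / (s + t)) • (x + s • u + t • u) = x + t • u := by
    match_scalars <;> field_simp
  rw [e1] at h1
  rw [e2] at h2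
  simp only [smul_eq_mul] at h1 h2
  have e3 : t / (s + t) * f x + s / (s + t) * f (x + s • u + t • u) +
    (s / (s + t) * f x + t / (s + t) * f (x + s • u + t • u)) =
      f (x + s • u + t • u) + f x := by field_simp; ring
  linarith

end SecondDifference

/-! ### Monotone functions and their mollifications -/

section Mollify

variable {n : ℕ}

lemma const_le_of_norm_le {z : Fin n → ℝ} {r : ℝ} (hz : ‖z‖ ≤ r) :
    (fun _ => -r) ≤ z ∧ z ≤ fun _ => r := by
  refine ⟨fun i => ?_, fun i => ?_⟩ <;>
  · have := (norm_le_pi_norm z i).trans hz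
    rw [Real.norm_eq_abs, abs_le] at this
    linarith [this.1, this.2]

/-- The sup-norm ball is an order interval, so its two extreme corners bound `f`. This local bound
replaces any continuity or moment assumption on monotone functions. -/
lemma _root_.Monotone.abs_le_of_norm_le {f : (Fin n → ℝ) → ℝ} (hf : Monotone f) {z : Fin n → ℝ}
    {r : ℝ} (hz : ‖z‖ ≤ r) : |f z| ≤ |f fun _ => -r| + |f fun _ => r| := by
  obtain ⟨h1, h2⟩ := const_le_of_norm_le hz
  have h1 := hf h1
  have h2 := hf h2
  rw [abs_le]
  constructor
  · linarith [neg_abs_le (f fun _ => -r), abs_nonneg (f fun _ => r)]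
  · linarith [le_abs_self (f fun _ => r), abs_nonneg (f fun _ => -r)]

lemma _root_.Monotone.locallyIntegrable_pi {f : (Fin n → ℝ) → ℝ} (hf : Monotone f)
    (hm : Measurable f) : LocallyIntegrable f := by
  rw [locallyIntegrable_iff]
  intro k hk
  obtain ⟨r, hr⟩ := hk.isBounded.exists_norm_le
  refine Measure.integrableOn_of_bounded (M := |f fun _ => -r| + |f fun _ => r|)
    hk.measure_lt_top.ne hm.aestronglyMeasurable ?_
  refine (ae_restrict_iff' hk.measurableSet).2 (Eventually.of_forall fun z hz => ?_)
  exact hf.abs_le_of_norm_le (hr z hz)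

/-- The mollification of `f` by a smooth bump. -/
def mollify (φ : ContDiffBump (0 : Fin n → ℝ)) (f : (Fin n → ℝ) → ℝ) (z : Fin n → ℝ) : ℝ :=
  ∫ t, φ.normed volume t * f (z - t)

variable (φ : ContDiffBump (0 : Fin n → ℝ)) {f : (Fin n → ℝ) → ℝ}

lemma mollify_eq_convolution : mollify φ f =
    convolution (φ.normed volume) f (ContinuousLinearMap.lsmul ℝ ℝ) volume := by
  ext z; simp [mollify, convolution_def]

lemma integrable_mollify (hf : LocallyIntegrable f) (z : Fin n → ℝ) :
    Integrable fun t => φ.normed volume t * f (z - t) := by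
  have := HasCompactSupport.convolutionExists_left (ContinuousLinearMap.lsmul ℝ ℝ)
    (φ.hasCompactSupport_normed (μ := volume)) φ.continuous_normed hf z
  simpa [ConvolutionExistsAt] using this

lemma contDiff_mollify (hf : LocallyIntegrable f) : ContDiff ℝ 2 (mollify φ f) := by
  rw [mollify_eq_convolution]
  exact HasCompactSupport.contDiff_convolution_left (n := 2) _ φ.hasCompactSupport_normed
    φ.contDiff_normed hf

lemma mollify_mono (hf : Monotone f) (hfi : LocallyIntegrable f) : Monotone (mollify φ f) := by
  intro x y hxy
  refine integral_mono (integrable_mollify φ hfi x) (integrable_mollify φ hfi y) fun t => ?_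
  exact mul_le_mul_of_nonneg_left (hf (sub_le_sub_right hxy t)) (φ.nonneg_normed t)

/-- The inequality is invariant under translation of the base point and under non-negative
averaging, and a mollification is such an average. -/
lemma SecondDiffNonneg.mollify {u v : Fin n → ℝ} (hf : SecondDiffNonneg f u v)
    (hfi : LocallyIntegrable f) : SecondDiffNonneg (mollify φ f) u v := by
  intro x s t hs ht
  unfold SkewElliptical.mollify
  rw [← integral_add (integrable_mollify φ hfi _) (integrable_mollify φ hfi _),
    ← integral_add (integrable_mollify φ hfi _) (integrable_mollify φ hfi _)]
  refine integral_mono ((integrable_mollify φ hfi _).add (integrable_mollify φ hfi _))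
    ((integrable_mollify φ hfi _).add (integrable_mollify φ hfi _)) fun τ => ?_
  have := hf (x - τ) s t hs ht
  simp only [← mul_add]
  refine mul_le_mul_of_nonneg_left ?_ (φ.nonneg_normed τ)
  have e1 : x + s • u - τ = x - τ + s • u := by module
  have e2 : x + t • v - τ = x - τ + t • v := by module
  have e3 : x + s • u + t • v - τ = x - τ + s • u + t • v := by module
  rwa [e1, e2, e3]

lemma abs_mollify_le (hφ : φ.rOut ≤ 1) (hf : Monotone f)
    {z : Fin n → ℝ} {r : ℝ} (hz : ‖z‖ ≤ r) :
    |mollify φ f z| ≤ |f fun _ => -(r + 1)| + |f fun _ => r + 1| := by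
  set C := |f fun _ => -(r + 1)| + |f fun _ => r + 1|
  have h1 : ∀ t, ‖φ.normed volume t * f (z - t)‖ ≤ φ.normed volume t * C := by
    intro t
    rw [norm_mul, Real.norm_eq_abs, Real.norm_eq_abs, abs_of_nonneg (φ.nonneg_normed t)]
    by_cases ht : ‖t‖ ≤ 1
    · refine mul_le_mul_of_nonneg_left (hf.abs_le_of_norm_le ?_) (φ.nonneg_normed t)
      exact (norm_sub_le _ _).trans (add_le_add hz ht)
    · have : φ.normed volume t = 0 := by
        by_contra h0
        have := φ.support_normed_eq (μ := volume) ▸ Function.mem_support.2 h0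
        rw [Metric.mem_ball, dist_zero_right] at this
        exact ht (this.le.trans hφ)
      simp [this]
  have h2 := norm_integral_le_of_norm_le (φ.integrable_normed.mul_const C)
    (Eventually.of_forall h1)
  rw [integral_mul_const, φ.integral_normed, one_mul] at h2
  exact h2

/-- A shrinking sequence of bumps. -/
def bumpSeq (n k : ℕ) : ContDiffBump (0 : Fin n → ℝ) where
  rIn := 1 / (2 * (k + 1))
  rOut := 1 / (k + 1)
  rIn_pos := by positivity
  rIn_lt_rOut := by
    apply one_div_lt_one_div_of_lt <;> linarith [(Nat.cast_nonneg k : (0 : ℝ) ≤ k)]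

lemma bumpSeq_rOut_le_one (n k : ℕ) : (bumpSeq n k).rOut ≤ 1 := by
  simp only [bumpSeq]
  rw [div_le_one (by positivity)]
  linarith [(Nat.cast_nonneg k : (0 : ℝ) ≤ k)]

lemma ae_tendsto_mollify (hf : LocallyIntegrable f) :
    ∀ᵐ z, Tendsto (fun k => mollify (bumpSeq n k) f z) atTop (𝓝 (f z)) := by
  simp only [mollify_eq_convolution]
  -- The constant 2 is the ratio of the outer to the inner radius of the bumps. Convergence is only
  -- almost everywhere, as `f` may be discontinuous.
  refine ContDiffBump.ae_convolution_tendsto_right_of_locallyIntegrable (K := 2)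
    tendsto_one_div_add_atTop_nhds_zero_nat (Eventually.of_forall fun k => ?_) hf
  simp only [bumpSeq]
  apply le_of_eq
  field_simp

end Mollify

/-! ### From smooth to monotone functions, and from the half-space to the whole space -/

section Comparison

variable {n : ℕ}

/-- For radial weights, the average of `f (δy w + Ky z)` over the half-space `w > 0` is at least
the average of `f (δx w + Kx z)`. -/
def HalfSpaceLe (f : (Fin n → ℝ) → ℝ) (δx δy : Fin n → ℝ) (Kx Ky : Matrix (Fin n) (Fin n) ℝ) :
    Prop :=
  ∀ (p : ℝ → ℝ) (R : ℝ), Continuous p → (∀ s, 0 ≤ p s) → (∀ s, R ≤ s → p s = 0) →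
    ∫ v, posStep (v (Sum.inl ())) * f (sndCLM n (skewMatrix δx Kx *ᵥ v)) * p (sumSq v) ≤
      ∫ v, posStep (v (Sum.inl ())) * f (sndCLM n (skewMatrix δy Ky *ᵥ v)) * p (sumSq v)

lemma exists_norm_le_of_continuous {E : Type*} [NormedAddCommGroup E] {ι : Type*} [Fintype ι]
    {T : (ι → ℝ) → E} (hT : Continuous T) (R : ℝ) : ∃ r, ∀ v, sumSq v ≤ R → ‖T v‖ ≤ r := by
  obtain ⟨r, hr⟩ := (isCompact_sumSq_le (ι := ι) R).exists_bound_of_continuousOn hT.continuousOn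
  exact ⟨r, fun v hv => hr v hv⟩

lemma measurable_posStep_mul {h : (Unit ⊕ Fin n → ℝ) → ℝ} (hh : Measurable h) :
    Measurable fun v => posStep (v (Sum.inl ())) * h v :=
  (measurable_posStep.comp (measurable_pi_apply _)).mul hh

lemma abs_posStep_mul_le (t a : ℝ) : |posStep t * a| ≤ |a| := by
  rw [abs_mul]
  exact mul_le_of_le_one_left (abs_nonneg _) (abs_posStep_le t)

/-- Preimages of null sets under a surjective linear map are null, so almost everywhere convergence
of mollifications can be pulled back. -/
lemma surjective_snd_skewMatrix {δ : Fin n → ℝ} {K : Matrix (Fin n) (Fin n) ℝ} (hK : K.det ≠ 0) :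
    Function.Surjective fun v => sndCLM n (skewMatrix δ K *ᵥ v) := by
  intro z
  refine ⟨Sum.elim (fun _ => 0) (K⁻¹ *ᵥ z), ?_⟩
  ext i
  simp only [sndCLM_apply, skewMatrix_mulVec_inr]
  simp [Function.comp_def, mulVec_mulVec, Matrix.mul_nonsing_inv _ hK.isUnit]

lemma tendsto_integral_mollify {p : ℝ → ℝ} {R : ℝ} (hp : Continuous p)
    (hR : ∀ s, R ≤ s → p s = 0) {f : (Fin n → ℝ) → ℝ} (hf : Monotone f) (hm : Measurable f)
    {δ : Fin n → ℝ} {K : Matrix (Fin n) (Fin n) ℝ} (hK : K.det ≠ 0) :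
    Tendsto (fun k => ∫ v, posStep (v (Sum.inl ())) *
        mollify (bumpSeq n k) f (sndCLM n (skewMatrix δ K *ᵥ v)) * p (sumSq v)) atTop
      (𝓝 (∫ v, posStep (v (Sum.inl ())) * f (sndCLM n (skewMatrix δ K *ᵥ v)) * p (sumSq v))) := by
  have hfi := hf.locallyIntegrable_pi hm
  have hT := continuous_snd_skewMatrix δ K
  obtain ⟨r, hr⟩ := exists_norm_le_of_continuous hT R
  set C := |f fun _ => -(r + 1)| + |f fun _ => r + 1| with hC
  have hae : ∀ᵐ v : Unit ⊕ Fin n → ℝ, Tendsto (fun k => mollify (bumpSeq n k) f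
      (sndCLM n (skewMatrix δ K *ᵥ v))) atTop (𝓝 (f (sndCLM n (skewMatrix δ K *ᵥ v)))) := by
    have hmeas : MeasurableSet
        {z | Tendsto (fun k => mollify (bumpSeq n k) f z) atTop (𝓝 (f z))} := by
      have h1 : ∀ k, Measurable fun z => mollify (bumpSeq n k) f z - f z := fun k =>
        (contDiff_mollify (bumpSeq n k) hfi).continuous.measurable.sub hm
      have h2 := measurableSet_tendsto (𝓝 (0 : ℝ)) h1 (l := atTop)
      convert h2 using 3 with z
      exact tendsto_sub_nhds_zero_iff.symm
    have := (ae_comp_linearMap_mem_iff ((sndCLM n).toLinearMap ∘ₗ (skewMatrix δ K).mulVecLin)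
      volume volume (surjective_snd_skewMatrix hK) hmeas).2 (ae_tendsto_mollify hfi)
    exact this
  refine tendsto_integral_of_dominated_convergence (fun v => C * |p (sumSq v)|) (fun k => ?_) ?_
    (fun k => Eventually.of_forall fun v => ?_) ?_
  · exact ((measurable_posStep_mul ((contDiff_mollify (bumpSeq n k) hfi).continuous.measurable.comp
      hT.measurable)).mul (hp.measurable.comp continuous_sumSq.measurable)).aestronglyMeasurable
  · have := (integrable_mul_radial (ι := Unit ⊕ Fin n) hp hR (h := fun _ => 1)
      continuous_const).abs
    simp only [one_mul] at this
    exact this.const_mul C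
  · rw [Real.norm_eq_abs, abs_mul]
    by_cases hv : sumSq v ≤ R
    · refine mul_le_mul_of_nonneg_right ((abs_posStep_mul_le _ _).trans ?_) (abs_nonneg _)
      exact abs_mollify_le _ (bumpSeq_rOut_le_one n k) hf (hr v hv)
    · simp [hR _ (not_le.1 hv).le]
  · filter_upwards [hae] with v hv
    exact (hv.const_mul _).mul_const _

lemma halfSpaceLe_of_contDiff {f : (Fin n → ℝ) → ℝ} (hf : ContDiff ℝ 2 f) {δx δy : Fin n → ℝ}
    {Kx Ky Ωx Ωy : Matrix (Fin n) (Fin n) ℝ} (hdx : Kx.det ≠ 0) (hdy : Ky.det ≠ 0)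
    (hΩx : vecMulVec δx δx + Kx * Kxᵀ = Ωx) (hΩy : vecMulVec δy δy + Ky * Kyᵀ = Ωy)
    (hδ : δx ≤ δy) (hgrad : ∀ z i, 0 ≤ fderiv ℝ f z (Pi.single i 1))
    (hpos : ∀ z, 0 ≤ ∑ i, ∑ j, (Ωy - Ωx) i j *
      fderiv ℝ (fderiv ℝ f) z (Pi.single i 1) (Pi.single j 1)) :
    HalfSpaceLe f δx δy Kx Ky := fun _ _ hp hp0 hR =>
  integral_posStep_le_of_contDiff hp hp0 hR hf hdx hdy hΩx hΩy hδ hgrad hpos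

/-- `halfSpaceLe_of_contDiff` for monotone functions, whose second order behaviour is described by
second differences in a set `D` of pairs of directions. -/
lemma halfSpaceLe_of_secondDiff {f : (Fin n → ℝ) → ℝ} (hf : Monotone f) (hm : Measurable f)
    {δx δy : Fin n → ℝ}
    {Kx Ky Ωx Ωy : Matrix (Fin n) (Fin n) ℝ} (hdx : Kx.det ≠ 0) (hdy : Ky.det ≠ 0)
    (hΩx : vecMulVec δx δx + Kx * Kxᵀ = Ωx) (hΩy : vecMulVec δy δy + Ky * Kyᵀ = Ωy)
    (hδ : δx ≤ δy) (D : Set ((Fin n → ℝ) × (Fin n → ℝ)))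
    (hD : ∀ q ∈ D, SecondDiffNonneg f q.1 q.2)
    (hcone : ∀ B : (Fin n → ℝ) →L[ℝ] (Fin n → ℝ) →L[ℝ] ℝ, (∀ q ∈ D, 0 ≤ B q.1 q.2) →
      0 ≤ ∑ i, ∑ j, (Ωy - Ωx) i j * B (Pi.single i 1) (Pi.single j 1)) :
    HalfSpaceLe f δx δy Kx Ky := by
  intro p R hp hp0 hR
  have hfi := hf.locallyIntegrable_pi hm
  refine le_of_tendsto_of_tendsto' (tendsto_integral_mollify hp hR hf hm hdx)
    (tendsto_integral_mollify hp hR hf hm hdy) fun k => ?_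
  have hs := contDiff_mollify (bumpSeq n k) hfi
  have hd : Differentiable ℝ (mollify (bumpSeq n k) f) := hs.differentiable (by simp)
  have hd' : Differentiable ℝ (fderiv ℝ (mollify (bumpSeq n k) f)) :=
    (hs.fderiv_right (m := 1) (by norm_num)).differentiable (by simp)
  refine integral_posStep_le_of_contDiff hp hp0 hR hs hdx hdy hΩx hΩy hδ (fun z i => ?_)
    fun z => hcone _ fun q hq => ((hD q hq).mollify _ hfi).fderiv_nonneg hd hd' z
  have h1 : Monotone fun t : ℝ => mollify (bumpSeq n k) f (z + t • Pi.single i 1) := by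
    intro s t hst
    refine mollify_mono _ hf hfi (add_le_add_right (smul_le_smul_of_nonneg_right hst ?_) z)
    exact Pi.single_nonneg.2 zero_le_one
  have h2 := h1.deriv_nonneg (x := 0)
  rw [(hasDerivAt_line hd z _ 0).deriv] at h2
  simpa using h2

/-- The map `(w, z) ↦ μ + δ |w| + K z`. -/
def skewPoint (μ δ : Fin n → ℝ) (K : Matrix (Fin n) (Fin n) ℝ) (v : Unit ⊕ Fin n → ℝ) :
    Fin n → ℝ :=
  fun i => μ i + (δ i * |v (Sum.inl ())| + (K *ᵥ (v ∘ Sum.inr)) i)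

lemma continuous_skewPoint (μ δ : Fin n → ℝ) (K : Matrix (Fin n) (Fin n) ℝ) :
    Continuous (skewPoint μ δ K) := by
  refine continuous_pi fun i => ?_
  unfold skewPoint mulVec dotProduct
  simp only [Function.comp_def]
  fun_prop

/-- A function that is even in the coordinate `w` has twice its average over `w > 0`. -/
lemma integral_radial_eq_two_mul {p : ℝ → ℝ} {R : ℝ} (hp : Continuous p)
    (hR : ∀ s, R ≤ s → p s = 0) {h : (Unit ⊕ Fin n → ℝ) → ℝ} (hh : Measurable h) {C : ℝ}
    (hC : ∀ v, sumSq v ≤ R → |h v| ≤ C)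
    (heven : ∀ v w : Unit ⊕ Fin n → ℝ, v (Sum.inl ()) = -w (Sum.inl ()) →
      (∀ i, v (Sum.inr i) = w (Sum.inr i)) → h v = h w) :
    ∫ v, h v * p (sumSq v) = 2 * ∫ v, posStep (v (Sum.inl ())) * h v * p (sumSq v) := by
  -- The reflection w ↦ -w exchanges the two half-spaces and preserves both `h` and the weight; the
  -- hyperplane w = 0 is null.
  set O : Matrix (Unit ⊕ Fin n) (Unit ⊕ Fin n) ℝ := fromBlocks (-1) 0 0 1 with hOdef
  have hO : Oᵀ * O = 1 := by
    rw [hOdef, fromBlocks_transpose, fromBlocks_multiply]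
    simp [fromBlocks_one]
  have hO1 : ∀ v, (O *ᵥ v) (Sum.inl ()) = -v (Sum.inl ()) := by
    intro v; simp [O, mulVec, dotProduct, Fintype.sum_sum_type]
  have hO2 : ∀ v i, (O *ᵥ v) (Sum.inr i) = v (Sum.inr i) := by
    intro v i; simp [O, mulVec, dotProduct, Fintype.sum_sum_type, Matrix.one_apply]
  have hint := integrable_mul_radial_of_bdd hp hR (measurable_posStep_mul hh) (C := C)
    fun v hv => (abs_posStep_mul_le _ _).trans (hC v hv)
  have hinv := integral_mulVec_radial hO p (measurable_posStep_mul hh) hp.measurable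
  have hmeas : Measurable fun v : Unit ⊕ Fin n → ℝ => posStep (-v (Sum.inl ())) * h v :=
    (measurable_posStep.comp (measurable_pi_apply _).neg).mul hh
  have hint' := integrable_mul_radial_of_bdd hp hR hmeas (C := C)
    fun v hv => (abs_posStep_mul_le _ _).trans (hC v hv)
  have e : ∀ v, h (O *ᵥ v) = h v := fun v => heven _ _ (hO1 v) (hO2 v)
  simp only [hO1, e] at hinv
  have hnull : ∀ᵐ v : Unit ⊕ Fin n → ℝ, v (Sum.inl ()) ≠ 0 := by
    have := Measure.pi_hyperplane (fun _ : Unit ⊕ Fin n => (volume : Measure ℝ)) (Sum.inl ()) 0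
    rw [ae_iff, volume_pi]
    simpa using this
  have hsplit : ∫ v, h v * p (sumSq v) = (∫ v, posStep (v (Sum.inl ())) * h v * p (sumSq v)) +
      ∫ v, posStep (-v (Sum.inl ())) * h v * p (sumSq v) := by
    rw [← integral_add hint hint']
    refine integral_congr_ae ?_
    filter_upwards [hnull] with v hv
    rcases lt_or_gt_of_ne hv with h0 | h0
    · simp [posStep, h0, h0.not_gt]
    · simp [posStep, h0, h0.not_gt]
  rw [hsplit, hinv, two_mul]

/-- For w > 0 one has |w| = w, so `skewPoint` agrees with the shifted linear map. The skewness and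
scale are changed at fixed location `μx`; then the location is raised, pointwise by monotonicity. -/
lemma integral_skewPoint_le {f : (Fin n → ℝ) → ℝ} (hf : Monotone f) (hm : Measurable f)
    {μx μy δx δy : Fin n → ℝ} {Kx Ky : Matrix (Fin n) (Fin n) ℝ} (hμ : μx ≤ μy)
    (hle : HalfSpaceLe (fun z => f (μx + z)) δx δy Kx Ky) {p : ℝ → ℝ} {R : ℝ}
    (hp : Continuous p) (hp0 : ∀ s, 0 ≤ p s) (hR : ∀ s, R ≤ s → p s = 0) :
    ∫ v, f (skewPoint μx δx Kx v) * p (sumSq v) ≤ ∫ v, f (skewPoint μy δy Ky v) * p (sumSq v) := by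
  have hbdd : ∀ μ δ K, ∃ C, ∀ v, sumSq v ≤ R → |f (skewPoint μ δ K v)| ≤ C := by
    intro μ δ K
    obtain ⟨r, hr⟩ := exists_norm_le_of_continuous (continuous_skewPoint μ δ K) R
    exact ⟨_, fun v hv => hf.abs_le_of_norm_le (hr v hv)⟩
  have hmeas : ∀ μ δ K, Measurable fun v => f (skewPoint μ δ K v) := fun μ δ K =>
    hm.comp (continuous_skewPoint μ δ K).measurable
  have hint : ∀ μ δ K, Integrable fun v => f (skewPoint μ δ K v) * p (sumSq v) := by
    intro μ δ K
    obtain ⟨C, hC⟩ := hbdd μ δ K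
    exact integrable_mul_radial_of_bdd hp hR (hmeas μ δ K) hC
  have htwo : ∀ δ K, ∫ v, f (skewPoint μx δ K v) * p (sumSq v) =
      2 * ∫ v, posStep (v (Sum.inl ())) * f (μx + sndCLM n (skewMatrix δ K *ᵥ v)) *
        p (sumSq v) := by
    intro δ K
    obtain ⟨C, hC⟩ := hbdd μx δ K
    rw [integral_radial_eq_two_mul hp hR (hmeas μx δ K) hC]
    · congr 1
      refine integral_congr_ae (Eventually.of_forall fun v => ?_)
      simp only [posStep]
      split_ifs with h
      · congr 3
        ext i
        simp only [skewPoint, Pi.add_apply, sndCLM_apply, skewMatrix_mulVec_inr, abs_of_pos h]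
      · simp
    · intro v w h1 h2
      have h3 : v ∘ Sum.inr = w ∘ Sum.inr := funext h2
      have h4 : skewPoint μx δ K v = skewPoint μx δ K w := by
        ext i; simp only [skewPoint, h1, h3, abs_neg]
      rw [h4]
  calc _ ≤ ∫ v, f (skewPoint μx δy Ky v) * p (sumSq v) := by
        rw [htwo, htwo]
        exact mul_le_mul_of_nonneg_left (hle p R hp hp0 hR) zero_le_two
    _ ≤ _ := by
        refine integral_mono (hint _ _ _) (hint _ _ _) fun v => ?_
        exact mul_le_mul_of_nonneg_right (hf fun i => add_le_add_left (hμ i) _) (hp0 _)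

end Comparison

/-! ### From continuous weights to a measurable density generator -/

section Generator

variable {ι : Type*} [Fintype ι]

/-- L¹ distances between radial functions are L¹ distances on the line for this image measure; local
finiteness makes compactly supported continuous functions dense there. -/
lemma isFiniteMeasureOnCompacts_map_sumSq :
    IsFiniteMeasureOnCompacts (Measure.map (sumSq : (ι → ℝ) → ℝ) volume) where
  lt_top_of_isCompact K hK := by
    rw [Measure.map_apply continuous_sumSq.measurable hK.measurableSet]
    obtain ⟨r, hr⟩ := hK.isBounded.exists_norm_le
    refine (measure_mono fun v hv => ?_).trans_lt (isCompact_sumSq_le (ι := ι) r).measure_lt_top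
    exact (le_abs_self _).trans (hr _ hv)

/-- Truncated radial densities are approximated in `L¹` by continuous ones. -/
lemma exists_continuous_radial_approx {g : ℝ → ℝ} (hg : Measurable g) (hg0 : ∀ s, 0 ≤ s → 0 ≤ g s)
    (hgi : Integrable fun v : ι → ℝ => g (sumSq v)) (r : ℝ) {ε : ℝ} (hε : 0 < ε) :
    ∃ p : ℝ → ℝ, Continuous p ∧ (∀ s, 0 ≤ p s) ∧ (∀ s, r + 1 ≤ s → p s = 0) ∧
      Integrable (fun v : ι → ℝ => |(Set.Iic r).indicator g (sumSq v) - p (sumSq v)|) ∧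
      ∫ v : ι → ℝ, |(Set.Iic r).indicator g (sumSq v) - p (sumSq v)| ≤ ε := by
  have := isFiniteMeasureOnCompacts_map_sumSq (ι := ι)
  have hms : Measurable (sumSq : (ι → ℝ) → ℝ) := continuous_sumSq.measurable
  have hGm : Measurable ((Set.Iic r).indicator g) := hg.indicator measurableSet_Iic
  have hG : Integrable ((Set.Iic r).indicator g) (Measure.map (sumSq : (ι → ℝ) → ℝ) volume) := by
    rw [integrable_map_measure hGm.aestronglyMeasurable hms.aemeasurable]
    have := hgi.indicator (hms measurableSet_Iic : MeasurableSet (sumSq ⁻¹' Set.Iic r))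
    exact this
  obtain ⟨q, -, hqe, hqc, hqi⟩ := hG.exists_hasCompactSupport_integral_sub_le hε
  have hsubm : Measurable fun s => ‖(Set.Iic r).indicator g s - q s‖ :=
    (hGm.sub hqc.measurable).norm
  rw [integral_map hms.aemeasurable hsubm.aestronglyMeasurable] at hqe
  have hqi' : Integrable fun v : ι → ℝ => ‖(Set.Iic r).indicator g (sumSq v) - q (sumSq v)‖ :=
    ((hG.sub hqi).comp_measurable hms).norm
  -- The positive part and the cutoff make `q` admissible without increasing the error: up to `r`
  -- the cutoff is 1 and the target is non-negative; beyond `r` the target is 0 and |p| ≤ |q|.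
  set p : ℝ → ℝ := fun s => max (q s) 0 * max 0 (min 1 (r + 1 - s)) with hp
  have hpc : Continuous p := by simp only [hp]; fun_prop
  have hle : ∀ v : ι → ℝ, |(Set.Iic r).indicator g (sumSq v) - p (sumSq v)| ≤
      ‖(Set.Iic r).indicator g (sumSq v) - q (sumSq v)‖ := by
    intro v
    rw [Real.norm_eq_abs]
    rcases le_or_gt (sumSq v) r with h | h
    · have h1 : (Set.Iic r).indicator g (sumSq v) = g (sumSq v) := Set.indicator_of_mem (Set.mem_Iic.2 h) g
      have h2 : p (sumSq v) = max (q (sumSq v)) 0 := by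
        simp only [hp]
        rw [min_eq_left (by linarith), max_eq_right zero_le_one, mul_one]
      rw [h1, h2]
      have h3 := hg0 _ (sumSq_nonneg v)
      have h4 := abs_max_sub_max_le_abs (g (sumSq v)) (q (sumSq v)) 0
      rwa [max_eq_left h3] at h4
    · have h1 : (Set.Iic r).indicator g (sumSq v) = 0 :=
        Set.indicator_of_notMem (fun h' => h.not_ge (Set.mem_Iic.1 h')) g
      rw [h1, zero_sub, zero_sub, abs_neg, abs_neg]
      simp only [hp]
      rw [abs_mul]
      have h5 : |max 0 (min 1 (r + 1 - sumSq v))| ≤ 1 := by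
        rw [abs_of_nonneg (le_max_left _ _)]
        exact max_le zero_le_one (min_le_left _ _)
      have h6 : |max (q (sumSq v)) 0| ≤ |q (sumSq v)| := by
        rw [abs_of_nonneg (le_max_right _ _)]
        exact max_le (le_abs_self _) (abs_nonneg _)
      exact (mul_le_of_le_one_right (abs_nonneg _) h5).trans h6
  have hpi : Integrable fun v : ι → ℝ => |(Set.Iic r).indicator g (sumSq v) - p (sumSq v)| :=
    hqi'.mono' ((hGm.comp hms).sub (hpc.measurable.comp hms)).norm.aestronglyMeasurable
      (Eventually.of_forall fun v => by simpa using hle v)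
  refine ⟨p, hpc, fun s => mul_nonneg (le_max_right _ _) (le_max_left _ _), fun s hs => ?_,
    hpi, (integral_mono hpi hqi' hle).trans hqe⟩
  simp only [hp]
  rw [max_eq_left (min_le_of_right_le (by linarith)), mul_zero]

lemma integral_truncated_nonneg {g : ℝ → ℝ} (hg : Measurable g) (hg0 : ∀ s, 0 ≤ s → 0 ≤ g s)
    (hgi : Integrable fun v : ι → ℝ => g (sumSq v)) {k : (ι → ℝ) → ℝ} (hk : Measurable k)
    (hbdd : ∀ R, ∃ C, ∀ v, sumSq v ≤ R → |k v| ≤ C)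
    (hpos : ∀ (p : ℝ → ℝ) (R : ℝ), Continuous p → (∀ s, 0 ≤ p s) → (∀ s, R ≤ s → p s = 0) →
      0 ≤ ∫ v, k v * p (sumSq v)) (r : ℝ) :
    0 ≤ ∫ v, k v * (Set.Iic r).indicator g (sumSq v) := by
  obtain ⟨C, hC⟩ := hbdd (r + 1)
  set C' := max C 0 with hC'
  have hms : Measurable (sumSq : (ι → ℝ) → ℝ) := continuous_sumSq.measurable
  refine le_of_forall_pos_le_add fun ε hε => ?_
  -- Both weights vanish outside `sumSq v ≤ r + 1`, where |k| ≤ C', so the integrals differ by at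
  -- most C' ε / (C' + 1) ≤ ε.
  obtain ⟨p, hpc, hp0, hpR, hpi, hpe⟩ := exists_continuous_radial_approx hg hg0 hgi r
    (show 0 < ε / (C' + 1) by positivity)
  have h1 := hpos p (r + 1) hpc hp0 hpR
  have hpint := integrable_mul_radial_of_bdd hpc hpR hk hC
  have hle : ∀ v, |k v * (Set.Iic r).indicator g (sumSq v) - k v * p (sumSq v)| ≤
      C' * |(Set.Iic r).indicator g (sumSq v) - p (sumSq v)| := by
    intro v
    rw [← mul_sub, abs_mul]
    by_cases hv : sumSq v ≤ r + 1
    · exact mul_le_mul_of_nonneg_right ((hC v hv).trans (le_max_left _ _)) (abs_nonneg _)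
    · have h2 : (Set.Iic r).indicator g (sumSq v) = 0 :=
        Set.indicator_of_notMem (fun h => hv ((Set.mem_Iic.1 h).trans (by linarith))) g
      rw [h2, hpR _ (not_le.1 hv).le]
      simp
  have hdi : Integrable fun v => k v * (Set.Iic r).indicator g (sumSq v) - k v * p (sumSq v) :=
    (hpi.const_mul C').mono' ((hk.mul ((hg.indicator measurableSet_Iic).comp hms)).sub
      (hk.mul (hpc.measurable.comp hms))).aestronglyMeasurable
      (Eventually.of_forall fun v => by simpa using hle v)
  have hgint : Integrable fun v => k v * (Set.Iic r).indicator g (sumSq v) := by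
    refine (hdi.add hpint).congr (Eventually.of_forall fun v => ?_)
    simp
  have h3 : |∫ v, (k v * (Set.Iic r).indicator g (sumSq v) - k v * p (sumSq v))| ≤ ε := by
    rw [← Real.norm_eq_abs]
    calc _ ≤ ∫ v, C' * |(Set.Iic r).indicator g (sumSq v) - p (sumSq v)| :=
          norm_integral_le_of_norm_le (hpi.const_mul C') (Eventually.of_forall hle)
      _ ≤ C' * (ε / (C' + 1)) := by
          rw [integral_const_mul]
          exact mul_le_mul_of_nonneg_left hpe (le_max_right _ _)
      _ ≤ ε := by
          rw [mul_div_assoc', div_le_iff₀ (by positivity)]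
          nlinarith
  rw [integral_sub hgint hpint] at h3
  linarith [neg_abs_le (∫ v, k v * (Set.Iic r).indicator g (sumSq v) - ∫ v, k v * p (sumSq v)),
    (abs_le.1 h3).1]

end Generator

/-! ### Extended expectations as limits of truncated ones -/

section Expectation

/-- The crossed form a + d ≤ c + b passes to limits in `ENNReal`, where the differences themselves
could be ∞ - ∞. -/
lemma ereal_sub_le_sub {a b c d : ENNReal} (h : a + d ≤ c + b) (hab : a ≠ ⊤ ∨ b ≠ ⊤)
    (hcd : c ≠ ⊤ ∨ d ≠ ⊤) : (a : EReal) - b ≤ c - d := by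
  by_cases hc : c = ⊤
  · have hd : d ≠ ⊤ := hcd.resolve_left fun h => h hc
    lift d to NNReal using hd
    subst hc
    rw [show ((⊤ : ENNReal) : EReal) - ((d : ENNReal) : EReal) = ⊤ from EReal.top_sub_coe _]
    exact le_top
  by_cases hb : b = ⊤
  · subst hb
    rw [EReal.coe_ennreal_top, EReal.sub_top]
    exact bot_le
  have hcb : a + d ≠ ⊤ := (h.trans_lt (by simp [hc, hb, lt_top_iff_ne_top])).ne
  obtain ⟨ha, hd⟩ := ENNReal.add_ne_top.1 hcb
  lift a to NNReal using ha
  lift b to NNReal using hb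
  lift c to NNReal using hc
  lift d to NNReal using hd
  have h' : (a : ℝ) + d ≤ c + b := by exact_mod_cast h
  have h2 : (a : ℝ) - b ≤ c - d := by linarith
  have h3 : (((a : ℝ) - b : ℝ) : EReal) ≤ ((c : ℝ) - d : ℝ) := EReal.coe_le_coe_iff.2 h2
  exact h3

variable {α : Type*} [MeasurableSpace α] {ν : Measure α}

/-- Comparison of expectations from comparison of truncated ones. -/
lemma expectation_le_of_truncated {u w : α → ℝ}
    {s : ℕ → Set α} (hmono : Monotone s) (hU : ⋃ k, s k = Set.univ)
    (hui : ∀ k, IntegrableOn u (s k) ν) (hwi : ∀ k, IntegrableOn w (s k) ν)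
    (hle : ∀ k, ∫ x in s k, u x ∂ν ≤ ∫ x in s k, w x ∂ν)
    (hud : ExpectationDefined ν u) (hwd : ExpectationDefined ν w) :
    expectation ν u ≤ expectation ν w := by
  have htend : ∀ h : α → ENNReal, Tendsto (fun k => ∫⁻ x in s k, h x ∂ν) atTop
      (𝓝 (∫⁻ x, h x ∂ν)) := by
    intro h
    have h1 := setLIntegral_iUnion_of_directed (μ := ν) h hmono.directed_le
    rw [hU, Measure.restrict_univ] at h1
    rw [h1]
    exact tendsto_atTop_iSup fun i j hij => lintegral_mono_set (hmono hij)
  refine ereal_sub_le_sub ?_ hud hwd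
  refine le_of_tendsto_of_tendsto' ((htend _).add (htend _)) ((htend _).add (htend _)) fun k => ?_
  have h1 := hle k
  rw [integral_eq_lintegral_pos_part_sub_lintegral_neg_part (hui k),
    integral_eq_lintegral_pos_part_sub_lintegral_neg_part (hwi k)] at h1
  have hfin : ∀ {h : α → ℝ}, IntegrableOn h (s k) ν →
      ∫⁻ x in s k, ENNReal.ofReal (h x) ∂ν ≠ ⊤ := fun hh => hh.lintegral_lt_top.ne
  have a1 := hfin (hui k)
  have a2 := hfin (hui k).neg
  have a3 := hfin (hwi k)
  have a4 := hfin (hwi k).neg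
  simp only [Pi.neg_apply] at a2 a4
  rw [← ENNReal.toReal_le_toReal (ENNReal.add_ne_top.2 ⟨a1, a4⟩) (ENNReal.add_ne_top.2 ⟨a3, a2⟩),
    ENNReal.toReal_add a1 a4, ENNReal.toReal_add a3 a2]
  linarith

end Expectation

/-! ### Skew-elliptical laws as images of a spherical law -/

section Law

variable {ι : Type*} [Fintype ι]

/-- The spherical law with density generator `g`. -/
def spherical (ι : Type*) [Fintype ι] (g : ℝ → ℝ) : Measure (ι → ℝ) :=
  volume.withDensity fun v => ENNReal.ofReal (g (sumSq v))

lemma IsDensityGenerator.integrable {g : ℝ → ℝ} (hg : IsDensityGenerator ι g) :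
    Integrable fun v : ι → ℝ => g (sumSq v) := by
  refine ⟨(hg.measurable.comp continuous_sumSq.measurable).aestronglyMeasurable, ?_⟩
  rw [hasFiniteIntegral_iff_ofReal (Eventually.of_forall fun v => hg.nonneg _ (sumSq_nonneg v))]
  have := hg.lintegral_eq_one
  unfold sumSq
  rw [this]
  exact ENNReal.one_lt_top

lemma IsDensityGenerator.isProbabilityMeasure {g : ℝ → ℝ} (hg : IsDensityGenerator ι g) :
    IsProbabilityMeasure (spherical ι g) := by
  refine ⟨?_⟩
  rw [spherical, withDensity_apply _ MeasurableSet.univ, Measure.restrict_univ]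
  exact hg.lintegral_eq_one

lemma setIntegral_spherical {g : ℝ → ℝ} (hg : IsDensityGenerator ι g) (h : (ι → ℝ) → ℝ) (r : ℝ) :
    ∫ v in {v | sumSq v ≤ r}, h v ∂(spherical ι g) =
      ∫ v, h v * (Set.Iic r).indicator g (sumSq v) := by
  have hm : Measurable (sumSq : (ι → ℝ) → ℝ) := continuous_sumSq.measurable
  have hs : MeasurableSet {v : ι → ℝ | sumSq v ≤ r} := hm measurableSet_Iic
  have hgm : Measurable fun v : ι → ℝ => ENNReal.ofReal (g (sumSq v)) :=
    (hg.measurable.comp hm).ennreal_ofReal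
  rw [spherical, setIntegral_withDensity_eq_setIntegral_toReal_smul hgm (Eventually.of_forall fun _ => ENNReal.ofReal_lt_top) h hs,
    ← integral_indicator hs]
  refine integral_congr_ae (Eventually.of_forall fun v => ?_)
  by_cases hv : sumSq v ≤ r
  · have h1 : (Set.Iic r).indicator g (sumSq v) = g (sumSq v) :=
      Set.indicator_of_mem (Set.mem_Iic.2 hv) g
    have h2 : v ∈ {v : ι → ℝ | sumSq v ≤ r} := hv
    simp only [Set.indicator_of_mem h2, h1, smul_eq_mul,
      ENNReal.toReal_ofReal (hg.nonneg _ (sumSq_nonneg v))]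
    rw [mul_comm]
  · have h1 : (Set.Iic r).indicator g (sumSq v) = 0 :=
      Set.indicator_of_notMem (fun h' => hv (Set.mem_Iic.1 h')) g
    have h2 : v ∉ {v : ι → ℝ | sumSq v ≤ r} := hv
    simp only [Set.indicator_of_notMem h2, h1, mul_zero]

/-- An elliptical law is a linear image of the spherical law. -/
lemma elliptical_eq_map [DecidableEq ι] {g : ℝ → ℝ} (hg : Measurable g) {B : Matrix ι ι ℝ}
    (hB : B.det ≠ 0) :
    elliptical 0 (B * Bᵀ) g = (spherical ι g).map fun v => B *ᵥ v := by
  have hBu : IsUnit B.det := hB.isUnit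
  have hBm := measurable_mulVec B
  ext s hs
  rw [Measure.map_apply hBm hs, spherical, elliptical, withDensity_apply _ hs,
    withDensity_apply _ (hBm hs)]
  set ρ : (ι → ℝ) → ENNReal := fun w => ENNReal.ofReal (g (sumSq (B⁻¹ *ᵥ w))) with hρ
  have hρm : Measurable ρ := (hg.comp
    (continuous_sumSq.measurable.comp (measurable_mulVec B⁻¹))).ennreal_ofReal
  have h1 : ∀ v, ENNReal.ofReal (g (sumSq v)) = ρ (B *ᵥ v) := by
    intro v
    simp only [hρ, mulVec_mulVec, Matrix.nonsing_inv_mul _ hBu, one_mulVec]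
  have h2 : ∫⁻ v in (fun v => B *ᵥ v) ⁻¹' s, ENNReal.ofReal (g (sumSq v)) =
      ENNReal.ofReal |B.det⁻¹| * ∫⁻ w in s, ρ w := by
    simp only [h1]
    rw [← setLIntegral_map hs hρm hBm, map_mulVec_volume hB, Measure.restrict_smul,
      lintegral_smul_measure, smul_eq_mul]
  rw [h2, ← lintegral_const_mul _ hρm]
  refine lintegral_congr fun w => ?_
  rw [← ENNReal.ofReal_mul (abs_nonneg _)]
  congr 2
  · rw [det_mul, det_transpose, Real.sqrt_mul_self_eq_abs, abs_inv]
  · congr 1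
    rw [sub_zero, Matrix.mul_inv_rev, ← Matrix.transpose_nonsing_inv, ← mulVec_mulVec,
      dotProduct_mulVec, vecMul_transpose, sumSq_eq_dotProduct]

open scoped MatrixOrder Matrix.Norms.L2Operator in
lemma exists_eq_mul_transpose [DecidableEq ι] {S : Matrix ι ι ℝ} (hS : S.PosSemidef) :
    ∃ D : Matrix ι ι ℝ, S = D * Dᵀ := by
  obtain ⟨a, rfl⟩ := CStarAlgebra.nonneg_iff_eq_star_mul_self.mp hS.nonneg
  exact ⟨aᵀ, by simp [star_eq_conjTranspose]⟩

variable {n : ℕ}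

/-- A skew-elliptical law is the image of the spherical law under `(w, z) ↦ μ + δ_ω |w| + K z`,
where `K K' = Ω - δ_ω δ_ω'`. -/
lemma IsSkewElliptical.exists_factor {A : Type*} [MeasurableSpace A] {P : Measure A}
    {X : A → Fin n → ℝ} {μ : Fin n → ℝ} {Om : Matrix (Fin n) (Fin n) ℝ} {δ : Fin n → ℝ} {g : ℝ → ℝ}
    (h : IsSkewElliptical P X μ Om δ g) :
    ∃ K : Matrix (Fin n) (Fin n) ℝ, K.det ≠ 0 ∧
      vecMulVec (deltaW Om δ) (deltaW Om δ) + K * Kᵀ = Om ∧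
      HasLaw X ((spherical (Unit ⊕ Fin n) g).map (skewPoint μ (deltaW Om δ) K)) P := by
  obtain ⟨D, hD⟩ := exists_eq_mul_transpose h.scaleU_posDef.posSemidef
  have hDdet : D.det ≠ 0 := by
    intro h0
    have := h.scaleU_posDef.det_pos
    rw [hD, det_mul, h0, zero_mul] at this
    exact lt_irrefl _ this
  -- `c` is the diagonal of ωΔ. With Ψ - λλ' = D Dᵀ, the matrix K = ωΔD satisfies K Kᵀ = ωΔ(Ψ -
  -- λλ')Δω = Ω - δ_w δ_w'.
  set c : Fin n → ℝ := fun i => √(Om i i) * √(1 - δ i ^ 2) with hc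
  have hOm : ∀ i, 0 < √(Om i i) := fun i => Real.sqrt_pos.2 h.scale_posDef.diag_pos
  have hδ : ∀ i, 0 < √(1 - δ i ^ 2) := by
    intro i
    have := h.delta_mem i
    refine Real.sqrt_pos.2 ?_
    nlinarith [this.1, this.2]
  have hcpos : ∀ i, 0 < c i := fun i => mul_pos (hOm i) (hδ i)
  refine ⟨diagonal c * D, ?_, ?_, ?_⟩
  · rw [det_mul, det_diagonal]
    exact mul_ne_zero (Finset.prod_ne_zero_iff.2 fun i _ => (hcpos i).ne') hDdet
  · have e : diagonal c * D * (diagonal c * D)ᵀ = diagonal c * scaleU Om δ * diagonal c := by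
      rw [hD, transpose_mul, diagonal_transpose]; simp only [Matrix.mul_assoc]
    rw [e]
    ext i j
    rw [Matrix.add_apply, mul_diagonal, diagonal_mul]
    simp only [scaleU, psi, lam, deltaW, vecMulVec_apply, Matrix.sub_apply, of_apply, hc]
    have h1 := (hOm i).ne'
    have h2 := (hOm j).ne'
    have h3 := (hδ i).ne'
    have h4 := (hδ j).ne'
    field_simp
    ring
  · set B : Matrix (Unit ⊕ Fin n) (Unit ⊕ Fin n) ℝ := fromBlocks 1 0 0 D with hBdef
    have hB : B.det ≠ 0 := by
      rw [hBdef, det_fromBlocks_zero₁₂]; simpa using hDdet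
    have hBB : fromBlocks 1 0 0 (scaleU Om δ) = B * Bᵀ := by
      rw [hBdef, fromBlocks_transpose, fromBlocks_multiply, hD]; simp
    have hlaw := h.hasLaw
    rw [hBB, elliptical_eq_map h.generator.measurable hB,
      Measure.map_map (by fun_prop) (measurable_mulVec B)] at hlaw
    convert hlaw using 2
    ext v i
    have b1 : (B *ᵥ v) (Sum.inl ()) = v (Sum.inl ()) := by
      simp [hBdef, mulVec, dotProduct, Fintype.sum_sum_type]
    have b2 : (B *ᵥ v) (Sum.inr i) = (D *ᵥ (v ∘ Sum.inr)) i := by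
      simp [hBdef, mulVec, dotProduct, Fintype.sum_sum_type]
    simp only [skewPoint, Function.comp_apply, b1, b2, deltaW, ← mulVec_mulVec, mulVec_diagonal, hc]
    ring

end Law

/-! ### Comparison of expectations of skew-elliptical vectors -/

section Order

variable {n : ℕ} {A B : Type*} [MeasurableSpace A] [MeasurableSpace B] {P : Measure A}
  {Q : Measure B} {X : A → Fin n → ℝ} {Y : B → Fin n → ℝ}

lemma lintegral_ofReal_comp_hasLaw {ι : Type*} [Fintype ι] {ν : Measure (ι → ℝ)}
    {T : (ι → ℝ) → Fin n → ℝ} (hT : Measurable T) (hX : HasLaw X (ν.map T) P)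
    {f : (Fin n → ℝ) → ℝ} (hf : Measurable f) :
    ∫⁻ a, ENNReal.ofReal (f (X a)) ∂P = ∫⁻ v, ENNReal.ofReal (f (T v)) ∂ν := by
  rw [hX.lintegral_comp (f := fun z => ENNReal.ofReal (f z)) hf.ennreal_ofReal.aemeasurable,
    lintegral_map hf.ennreal_ofReal hT]

/-- Both expectations are moved to the same spherical law and truncated to the same balls `sumSq v ≤
k`, on which the two integrands are bounded. Their difference is the function fed to
`integral_truncated_nonneg`. -/
lemma expectation_le_of_halfSpaceLe {g : ℝ → ℝ} (hg : IsDensityGenerator (Unit ⊕ Fin n) g)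
    {μx μy δx δy : Fin n → ℝ} {Kx Ky : Matrix (Fin n) (Fin n) ℝ}
    (hX : HasLaw X ((spherical (Unit ⊕ Fin n) g).map (skewPoint μx δx Kx)) P)
    (hY : HasLaw Y ((spherical (Unit ⊕ Fin n) g).map (skewPoint μy δy Ky)) Q)
    {f : (Fin n → ℝ) → ℝ} (hf : Monotone f) (hm : Measurable f) (hμ : μx ≤ μy)
    (hle : HalfSpaceLe (fun z => f (μx + z)) δx δy Kx Ky)
    (hXd : ExpectationDefined P fun a => f (X a)) (hYd : ExpectationDefined Q fun b => f (Y b)) :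
    expectation P (fun a => f (X a)) ≤ expectation Q (fun b => f (Y b)) := by
  have hTx := continuous_skewPoint μx δx Kx
  have hTy := continuous_skewPoint μy δy Ky
  have ex := lintegral_ofReal_comp_hasLaw hTx.measurable hX hm
  have ex' := lintegral_ofReal_comp_hasLaw hTx.measurable hX hm.neg
  have ey := lintegral_ofReal_comp_hasLaw hTy.measurable hY hm
  have ey' := lintegral_ofReal_comp_hasLaw hTy.measurable hY hm.neg
  simp only [Pi.neg_apply] at ex' ey'
  simp only [ExpectationDefined, expectation, ex, ex', ey, ey'] at hXd hYd ⊢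
  have hprob := hg.isProbabilityMeasure
  have hms : Measurable (sumSq : (Unit ⊕ Fin n → ℝ) → ℝ) := continuous_sumSq.measurable
  have hbdd : ∀ μ δ K (r : ℝ), ∃ C, ∀ v, sumSq v ≤ r → |f (skewPoint μ δ K v)| ≤ C := by
    intro μ δ K r
    obtain ⟨r', hr⟩ := exists_norm_le_of_continuous (continuous_skewPoint μ δ K) r
    exact ⟨_, fun v hv => hf.abs_le_of_norm_le (hr v hv)⟩
  have hmeas : ∀ μ δ K, Measurable fun v => f (skewPoint μ δ K v) := fun μ δ K =>
    hm.comp (continuous_skewPoint μ δ K).measurable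
  have hint : ∀ μ δ K (r : ℝ), IntegrableOn (fun v => f (skewPoint μ δ K v)) {v | sumSq v ≤ r}
      (spherical (Unit ⊕ Fin n) g) := by
    intro μ δ K r
    obtain ⟨C, hC⟩ := hbdd μ δ K r
    refine Measure.integrableOn_of_bounded (M := C) (measure_ne_top _ _)
      (hmeas μ δ K).aestronglyMeasurable ?_
    exact (ae_restrict_iff' (hms measurableSet_Iic)).2 (Eventually.of_forall fun v hv => hC v hv)
  refine expectation_le_of_truncated (s := fun k : ℕ => {v | sumSq v ≤ k}) ?_ ?_
    (fun k => hint _ _ _ _) (fun k => hint _ _ _ _) (fun k => ?_) hXd hYd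
  · intro i j hij v hv
    exact le_trans (show sumSq v ≤ i from hv) (Nat.cast_le.2 hij)
  · refine Set.eq_univ_of_forall fun v => Set.mem_iUnion.2 ?_
    exact exists_nat_ge (sumSq v)
  · rw [← sub_nonneg, ← integral_sub (hint _ _ _ _) (hint _ _ _ _), setIntegral_spherical hg]
    refine integral_truncated_nonneg hg.measurable hg.nonneg hg.integrable
      ((hmeas _ _ _).sub (hmeas _ _ _)) (fun r => ?_) (fun p R hp hp0 hR => ?_) k
    · obtain ⟨C, hC⟩ := hbdd μx δx Kx r
      obtain ⟨C', hC'⟩ := hbdd μy δy Ky r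
      exact ⟨C' + C, fun v hv => (abs_sub _ _).trans (add_le_add (hC' v hv) (hC v hv))⟩
    · obtain ⟨C, hC⟩ := hbdd μx δx Kx R
      obtain ⟨C', hC'⟩ := hbdd μy δy Ky R
      have := integral_skewPoint_le hf hm hμ hle hp hp0 hR
      change 0 ≤ ∫ v, (f (skewPoint μy δy Ky v) - f (skewPoint μx δx Kx v)) * p (sumSq v)
      simp only [sub_mul]
      rw [integral_sub (integrable_mul_radial_of_bdd hp hR (hmeas _ _ _) hC')
        (integrable_mul_radial_of_bdd hp hR (hmeas _ _ _) hC)]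
      linarith

variable {μx μy δx δy : Fin n → ℝ} {Ωx Ωy : Matrix (Fin n) (Fin n) ℝ} {g : ℝ → ℝ}

lemma expectation_le_of_contDiff (hX : IsSkewElliptical P X μx Ωx δx g)
    (hY : IsSkewElliptical Q Y μy Ωy δy g) (hμ : μx ≤ μy) (hδ : deltaW Ωx δx ≤ deltaW Ωy δy)
    {f : (Fin n → ℝ) → ℝ} (hf : ContDiff ℝ 2 f) (hmono : Monotone f)
    (hgrad : ∀ z i, 0 ≤ fderiv ℝ f z (Pi.single i 1))
    (hpos : ∀ z, 0 ≤ ∑ i, ∑ j, (Ωy - Ωx) i j *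
      fderiv ℝ (fderiv ℝ f) z (Pi.single i 1) (Pi.single j 1))
    (hXd : ExpectationDefined P fun a => f (X a)) (hYd : ExpectationDefined Q fun b => f (Y b)) :
    expectation P (fun a => f (X a)) ≤ expectation Q (fun b => f (Y b)) := by
  obtain ⟨Kx, hdx, hΩx, hlx⟩ := hX.exists_factor
  obtain ⟨Ky, hdy, hΩy, hly⟩ := hY.exists_factor
  have h1 : fderiv ℝ (fun z => f (μx + z)) = fun z => fderiv ℝ f (μx + z) := by
    ext1 z; exact fderiv_comp_add_left μx
  have h2 : ∀ z, fderiv ℝ (fun z => fderiv ℝ f (μx + z)) z = fderiv ℝ (fderiv ℝ f) (μx + z) :=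
    fun z => fderiv_comp_add_left μx
  refine expectation_le_of_halfSpaceLe hX.generator hlx hly hmono hf.continuous.measurable hμ
    (halfSpaceLe_of_contDiff (hf.comp (contDiff_const.add contDiff_id)) hdx hdy hΩx hΩy hδ
      (fun z i => ?_) fun z => ?_) hXd hYd
  · refine (hgrad (μx + z) i).trans_eq ?_
    exact congrArg (fun T => T z (Pi.single i 1)) h1.symm
  · refine (hpos (μx + z)).trans_eq ?_
    rw [← h2, ← h1]
    rfl

/-- Each order with possibly non-C² functions supplies its set `D` of pairs of directions; `hcone`
says that Ωy - Ωx lies in the dual of the bilinear forms non-negative on `D`. -/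
lemma expectation_le_of_secondDiff (hX : IsSkewElliptical P X μx Ωx δx g)
    (hY : IsSkewElliptical Q Y μy Ωy δy g) (hμ : μx ≤ μy) (hδ : deltaW Ωx δx ≤ deltaW Ωy δy)
    {f : (Fin n → ℝ) → ℝ} (hmono : Monotone f) (hm : Measurable f)
    (D : Set ((Fin n → ℝ) × (Fin n → ℝ))) (hD : ∀ q ∈ D, SecondDiffNonneg f q.1 q.2)
    (hcone : ∀ B : (Fin n → ℝ) →L[ℝ] (Fin n → ℝ) →L[ℝ] ℝ, (∀ q ∈ D, 0 ≤ B q.1 q.2) →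
      0 ≤ ∑ i, ∑ j, (Ωy - Ωx) i j * B (Pi.single i 1) (Pi.single j 1))
    (hXd : ExpectationDefined P fun a => f (X a)) (hYd : ExpectationDefined Q fun b => f (Y b)) :
    expectation P (fun a => f (X a)) ≤ expectation Q (fun b => f (Y b)) := by
  obtain ⟨Kx, hdx, hΩx, hlx⟩ := hX.exists_factor
  obtain ⟨Ky, hdy, hΩy, hly⟩ := hY.exists_factor
  refine expectation_le_of_halfSpaceLe hX.generator hlx hly hmono hm hμ
    (halfSpaceLe_of_secondDiff (fun a b hab => hmono (add_le_add_right hab μx))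
      (hm.comp (measurable_const.add measurable_id)) hdx hdy hΩx hΩy hδ D
      (fun q hq x s t hs ht => ?_) hcone) hXd hYd
  have := hD q hq (μx + x) s t hs ht
  simpa only [add_assoc] using this

end Order

/-! ### The cone duality behind each order -/

section Classes

variable {n : ℕ}

lemma hessian_apply {f : (Fin n → ℝ) → ℝ} (hf : Differentiable ℝ (fderiv ℝ f)) (x : Fin n → ℝ)
    (i j : Fin n) :
    hessian f x i j = fderiv ℝ (fderiv ℝ f) x (Pi.single i 1) (Pi.single j 1) := by
  have h := (hf x).hasFDerivAt.clm_apply (hasFDerivAt_const (Pi.single j (1 : ℝ)) x)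
  have h' : fderiv ℝ (partialDeriv j f) x = _ := h.fderiv
  simp [hessian, partialDeriv, h']

lemma NonnegGradient.monotone {f : (Fin n → ℝ) → ℝ} (h : NonnegGradient f)
    (hf : Differentiable ℝ f) : Monotone f := by
  intro x y hxy
  have h1 : Monotone fun t : ℝ => f (x + t • (y - x)) := by
    refine monotone_of_deriv_nonneg
      (fun t => (hasDerivAt_line hf x (y - x) t).differentiableAt) fun t => ?_
    rw [(hasDerivAt_line hf x (y - x) t).deriv]
    have e : y - x = ∑ i, (y i - x i) • (Pi.single i 1 : Fin n → ℝ) := by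
      ext j; simp [Pi.single_apply]
    rw [show fderiv ℝ f (x + t • (y - x)) (y - x) = fderiv ℝ f (x + t • (y - x))
      (∑ i, (y i - x i) • (Pi.single i 1 : Fin n → ℝ)) by rw [← e], map_sum]
    refine Finset.sum_nonneg fun i _ => ?_
    rw [map_smul]
    exact mul_nonneg (sub_nonneg.2 (hxy i)) (h _ i)
  simpa using h1 zero_le_one

/-- Supplies the pairs with i > j from the sign conditions imposed only for i < j. -/
lemma SecondDiffNonneg.symm {f : (Fin n → ℝ) → ℝ} {u v : Fin n → ℝ}
    (h : SecondDiffNonneg f u v) : SecondDiffNonneg f v u := by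
  intro x s t hs ht
  have := h x t s ht hs
  rw [add_right_comm]
  linarith

lemma TwiceDifferentiable.secondDiffNonneg {f : (Fin n → ℝ) → ℝ} (hf : TwiceDifferentiable f)
    {i j : Fin n} (h : ∀ x, 0 ≤ hessian f x i j) :
    SecondDiffNonneg f (Pi.single i 1) (Pi.single j 1) :=
  .of_fderiv hf.1 hf.2 fun x => by rw [← hessian_apply hf.2]; exact h x

/-- The trace pairing with a Gram matrix is a sum of values of the quadratic form of `M` at the rows
of `C`. Positive semi-definite and completely positive matrices enter the pairing in this way. -/
lemma sum_gram_mul {m : Type*} [Fintype m] (C : Matrix m (Fin n) ℝ) (M : Matrix (Fin n) (Fin n) ℝ) :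
    ∑ i, ∑ j, (Cᵀ * C) i j * M i j = ∑ k, C k ⬝ᵥ (M *ᵥ C k) := by
  simp only [mul_apply, transpose_apply, dotProduct, mulVec, Finset.mul_sum, Finset.sum_mul]
  rw [Finset.sum_comm' (t' := Finset.univ) (s' := fun _ => Finset.univ) (by simp)]
  conv_rhs => rw [Finset.sum_comm]; enter [2, i]; rw [Finset.sum_comm]
  rw [Finset.sum_comm]
  exact Finset.sum_congr rfl fun i _ => Finset.sum_congr rfl fun j _ =>
    Finset.sum_congr rfl fun k _ => by ring

variable {A B : Type*} [MeasurableSpace A] [MeasurableSpace B] {P : Measure A}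
  {Q : Measure B} {X : A → Fin n → ℝ} {Y : B → Fin n → ℝ}
  {μx μy δx δy : Fin n → ℝ} {Ωx Ωy : Matrix (Fin n) (Fin n) ℝ} {g : ℝ → ℝ}

theorem integralOrder_increasing (hX : IsSkewElliptical P X μx Ωx δx g)
    (hY : IsSkewElliptical Q Y μy Ωy δy g) (hμ : μx ≤ μy) (hδ : deltaW Ωx δx ≤ deltaW Ωy δy)
    (hΩ : Ωx = Ωy) : IntegralOrder (increasing n) P X Q Y := by
  intro f hf hm hXd hYd
  exact expectation_le_of_secondDiff hX hY hμ hδ hf hm ∅ (by simp) (fun B _ => by simp [hΩ]) hXd hYd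

theorem integralOrder_increasingConvex (hX : IsSkewElliptical P X μx Ωx δx g)
    (hY : IsSkewElliptical Q Y μy Ωy δy g) (hμ : μx ≤ μy) (hδ : deltaW Ωx δx ≤ deltaW Ωy δy)
    (hΩ : (Ωy - Ωx).PosSemidef) : IntegralOrder (increasingConvex n) P X Q Y := by
  intro f hf hm hXd hYd
  refine expectation_le_of_secondDiff hX hY hμ hδ hf.1 hm {q | q.1 = q.2} ?_ (fun B hB => ?_)
    hXd hYd
  · rintro ⟨u, v⟩ (rfl : u = v)
    exact secondDiffNonneg_of_convexOn hf.2 u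
  · obtain ⟨D, hD⟩ := exists_eq_mul_transpose hΩ
    have h := sum_gram_mul Dᵀ (of fun i j => B (Pi.single i 1) (Pi.single j 1))
    rw [transpose_transpose, ← hD] at h
    simp only [of_apply] at h
    rw [h]
    refine Finset.sum_nonneg fun k _ => (hB (Dᵀ k, Dᵀ k) rfl).trans_eq ?_
    rw [bilin_sum_eq]
    simp only [dotProduct, mulVec, of_apply, Finset.mul_sum]
    exact Finset.sum_congr rfl fun i _ => Finset.sum_congr rfl fun j _ => by ring

theorem integralOrder_increasingSupermodular (hX : IsSkewElliptical P X μx Ωx δx g)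
    (hY : IsSkewElliptical Q Y μy Ωy δy g) (hμ : μx ≤ μy) (hδ : deltaW Ωx δx ≤ deltaW Ωy δy)
    (hdiag : ∀ i, Ωx i i = Ωy i i) (hoff : ∀ i j, i ≠ j → Ωx i j ≤ Ωy i j) :
    IntegralOrder (increasingSupermodular n) P X Q Y := by
  rintro f ⟨hf, hgrad, hH⟩ hm hXd hYd
  refine expectation_le_of_secondDiff hX hY hμ hδ (hgrad.monotone hf.1) hm
    {q | ∃ i j, i ≠ j ∧ q = (Pi.single i 1, Pi.single j 1)} ?_ (fun B hB => ?_) hXd hYd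
  · rintro _ ⟨i, j, hij, rfl⟩
    rcases lt_or_gt_of_ne hij with h | h
    · exact hf.secondDiffNonneg fun x => hH x i j h
    · exact (hf.secondDiffNonneg fun x => hH x j i h).symm
  · refine Finset.sum_nonneg fun i _ => Finset.sum_nonneg fun j _ => ?_
    by_cases hij : i = j
    · subst hij; simp [hdiag]
    · exact mul_nonneg (sub_nonneg.2 (hoff i j hij)) (hB _ ⟨i, j, hij, rfl⟩)

theorem integralOrder_increasingDirConvex (hX : IsSkewElliptical P X μx Ωx δx g)
    (hY : IsSkewElliptical Q Y μy Ωy δy g) (hμ : μx ≤ μy) (hδ : deltaW Ωx δx ≤ deltaW Ωy δy)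
    (hΩ : ∀ i j, Ωx i j ≤ Ωy i j) : IntegralOrder (increasingDirConvex n) P X Q Y := by
  rintro f ⟨hf, hgrad, hH⟩ hm hXd hYd
  refine expectation_le_of_secondDiff hX hY hμ hδ (hgrad.monotone hf.1) hm
    {q | ∃ i j, q = (Pi.single i 1, Pi.single j 1)} ?_ (fun B hB => ?_) hXd hYd
  · rintro _ ⟨i, j, rfl⟩
    exact hf.secondDiffNonneg fun x => hH x i j
  · exact Finset.sum_nonneg fun i _ => Finset.sum_nonneg fun j _ =>
      mul_nonneg (sub_nonneg.2 (hΩ i j)) (hB _ ⟨i, j, rfl⟩)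

theorem integralOrder_increasingCompConvex (hX : IsSkewElliptical P X μx Ωx δx g)
    (hY : IsSkewElliptical Q Y μy Ωy δy g) (hμ : μx ≤ μy) (hδ : deltaW Ωx δx ≤ deltaW Ωy δy)
    (hdiag : ∀ i, Ωx i i ≤ Ωy i i) (hoff : ∀ i j, i < j → Ωx i j = Ωy i j) :
    IntegralOrder (increasingCompConvex n) P X Q Y := by
  rintro f ⟨hf, hgrad, hH⟩ hm hXd hYd
  refine expectation_le_of_secondDiff hX hY hμ hδ (hgrad.monotone hf.1) hm
    {q | ∃ i, q = (Pi.single i 1, Pi.single i 1)} ?_ (fun B hB => ?_) hXd hYd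
  · rintro _ ⟨i, rfl⟩
    exact hf.secondDiffNonneg fun x => hH x i
  · refine Finset.sum_nonneg fun i _ => Finset.sum_nonneg fun j _ => ?_
    rcases lt_trichotomy i j with h | rfl | h
    · simp [hoff i j h]
    · exact mul_nonneg (sub_nonneg.2 (hdiag i)) (hB _ ⟨i, rfl⟩)
    -- Entries below the diagonal agree because both scale matrices are symmetric.
    · have hx := hX.scale_posDef.isHermitian.apply i j
      have hy := hY.scale_posDef.isHermitian.apply i j
      simp only [star_trivial] at hx hy
      simp [← hx, ← hy, hoff j i h]

/-- The Hessian is the Gram matrix here: its non-negative rows are inserted into the copositive form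
Ωy - Ωx. In the copositive order the two roles are exchanged. -/
theorem integralOrder_increasingCP (hX : IsSkewElliptical P X μx Ωx δx g)
    (hY : IsSkewElliptical Q Y μy Ωy δy g) (hμ : μx ≤ μy) (hδ : deltaW Ωx δx ≤ deltaW Ωy δy)
    (hΩ : IsCopositive (Ωy - Ωx)) : IntegralOrder (increasingCP n) P X Q Y := by
  rintro f ⟨hf, hgrad, hH⟩ - hXd hYd
  have hd : Differentiable ℝ (fderiv ℝ f) :=
    (hf.fderiv_right (m := 1) (by norm_num)).differentiable (by simp)
  refine expectation_le_of_contDiff hX hY hμ hδ hf (hgrad.monotone (hf.differentiable (by simp)))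
    hgrad (fun z => ?_) hXd hYd
  obtain ⟨m, C, hC, hCH⟩ := hH z
  simp only [← hessian_apply hd, hCH]
  have h := sum_gram_mul C (Ωy - Ωx)
  simp only [mul_comm ((Cᵀ * C) _ _)] at h
  rw [h]
  exact Finset.sum_nonneg fun k _ => hΩ.2 _ (hC k)

theorem integralOrder_increasingCop (hX : IsSkewElliptical P X μx Ωx δx g)
    (hY : IsSkewElliptical Q Y μy Ωy δy g) (hμ : μx ≤ μy) (hδ : deltaW Ωx δx ≤ deltaW Ωy δy)
    (hΩ : IsCompletelyPositive (Ωy - Ωx)) : IntegralOrder (increasingCop n) P X Q Y := by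
  rintro f ⟨hf, hgrad, hH⟩ - hXd hYd
  have hd : Differentiable ℝ (fderiv ℝ f) :=
    (hf.fderiv_right (m := 1) (by norm_num)).differentiable (by simp)
  refine expectation_le_of_contDiff hX hY hμ hδ hf (hgrad.monotone (hf.differentiable (by simp)))
    hgrad (fun z => ?_) hXd hYd
  obtain ⟨m, C, hC, hCH⟩ := hΩ
  simp only [← hessian_apply hd, hCH]
  rw [sum_gram_mul C (hessian f z)]
  exact Finset.sum_nonneg fun k _ => (hH z).2 _ (hC k)

/-- Only index lists of length one and two are needed; higher mixed derivatives play no role. -/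
lemma upperOrthant_subset_increasingSupermodular :
    upperOrthant n ⊆ increasingSupermodular n := by
  rintro f ⟨hf, h⟩
  have hf2 : ContDiff ℝ 2 f := by exact_mod_cast contDiff_infty.1 hf 2
  refine ⟨⟨hf2.differentiable (by simp),
    (hf2.fderiv_right (m := 1) (by norm_num)).differentiable (by simp)⟩, fun x i => ?_,
    fun x i j hij => ?_⟩
  · exact h [i] (by simp) (by simp) x
  · exact h [i, j] (by simp) (by simpa using hij) x

end Classes

end SkewElliptical

end

theorem theorem3p6 {n : ℕ} {A B : Type*} [MeasurableSpace A] [MeasurableSpace B]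
    (P : MeasureTheory.Measure A) (Q : MeasureTheory.Measure B)
    (X : A → Fin n → ℝ) (Y : B → Fin n → ℝ)
    (μx μy : Fin n → ℝ) (Ωx Ωy : Matrix (Fin n) (Fin n) ℝ) (δx δy : Fin n → ℝ) (g : ℝ → ℝ)
    (hX : SkewElliptical.IsSkewElliptical P X μx Ωx δx g)
    (hY : SkewElliptical.IsSkewElliptical Q Y μy Ωy δy g)
    (hμ : μx ≤ μy)
    (hδ : SkewElliptical.deltaW Ωx δx ≤ SkewElliptical.deltaW Ωy δy) :
    -- (1) usual stochastic order
    (Ωx = Ωy →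
      SkewElliptical.IntegralOrder (SkewElliptical.increasing n) P X Q Y) ∧
    -- (2) increasing convex order
    ((Ωy - Ωx).PosSemidef →
      SkewElliptical.IntegralOrder (SkewElliptical.increasingConvex n) P X Q Y) ∧
    -- (3) increasing supermodular order
    ((∀ i, Ωx i i = Ωy i i) → (∀ i j, i ≠ j → Ωx i j ≤ Ωy i j) →
      SkewElliptical.IntegralOrder (SkewElliptical.increasingSupermodular n) P X Q Y) ∧
    -- (4) increasing directionally convex order
    ((∀ i j, Ωx i j ≤ Ωy i j) →
      SkewElliptical.IntegralOrder (SkewElliptical.increasingDirConvex n) P X Q Y) ∧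
    -- (5) increasing componentwise convex order
    ((∀ i, Ωx i i ≤ Ωy i i) → (∀ i j, i < j → Ωx i j = Ωy i j) →
      SkewElliptical.IntegralOrder (SkewElliptical.increasingCompConvex n) P X Q Y) ∧
    -- (6) increasing completely positive order
    (SkewElliptical.IsCopositive (Ωy - Ωx) →
      SkewElliptical.IntegralOrder (SkewElliptical.increasingCP n) P X Q Y) ∧
    -- (7) increasing copositive order
    (SkewElliptical.IsCompletelyPositive (Ωy - Ωx) →
      SkewElliptical.IntegralOrder (SkewElliptical.increasingCop n) P X Q Y) ∧
    -- (8) upper orthant order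
    ((∀ i, Ωx i i = Ωy i i) → (∀ i j, i ≠ j → Ωx i j ≤ Ωy i j) →
      SkewElliptical.IntegralOrder (SkewElliptical.upperOrthant n) P X Q Y) := by
  open SkewElliptical in
  exact ⟨integralOrder_increasing hX hY hμ hδ, integralOrder_increasingConvex hX hY hμ hδ,
    integralOrder_increasingSupermodular hX hY hμ hδ, integralOrder_increasingDirConvex hX hY hμ hδ,
    integralOrder_increasingCompConvex hX hY hμ hδ, integralOrder_increasingCP hX hY hμ hδ,
    integralOrder_increasingCop hX hY hμ hδ, fun hdiag hoff f hf =>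
      integralOrder_increasingSupermodular hX hY hμ hδ hdiag hoff f
        (upperOrthant_subset_increasingSupermodular hf)⟩
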